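/- Let $r\ge 2$. Let $\mathcal{C}l_{2r}$ be the complex Clifford algebra with generators $\Gamma_1,\dots,\Gamma_{2r}$ and relations $\Gamma_i\Gamma_j+\Gamma_j\Gamma_i=2\delta_{ij}$, let $\rho$ be an irreducible representation of it on a complex vector space $V$, and let $\Gamma_{2r+1}=(-i)^r\Gamma_1\cdots\Gamma_{2r}$. For $\epsilon,\epsilon'\in\{+1,-1\}$ put $P_\epsilon=\frac12(1+\epsilon\,\rho(\Gamma_{2r+1}))$ and $P_{\epsilon\epsilon'}=P_\epsilon\otimes P_{\epsilon'}$. Embed $\mathfrak{so}_{2r}$ (complex skew-symmetric matrices) in $\mathcal{C}l_{2r}$ by $e_{ij}-e_{ji}\mapsto\frac14[\Gamma_i,\Gamma_j]$, and write $\rho$ also for the resulting representation of $\mathfrak{so}_{2r}$ on $V$. Let $\widehat C_\rho=\sum_{A,B}\overline{\mathsf g}^{AB}\rho(X_A)\otimes\rho(X_B)$ be the split Casimir operator on $V\otimes V$, where $(X_A)$ is any basis of $\mathfrak{so}_{2r}$ and $(\overline{\mathsf g}^{AB})$ is the inverse of the matrix of the Killing form in this basis. Let $\widehat C_{\epsilon\epsilon'}=P_{\epsilon\epsilon'}\widehat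 C_\rho$, regarded as an operator on the image of $P_{\epsilon\epsilon'}$, which is the space of the tensor product $\Delta_\epsilon\otimes\Delta_{\epsilon'}$ of spinor representations of chiralities $\epsilon,\epsilon'$. For $k\ge 0$ let $I_k=\sum_{i_1,\dots,i_k=1}^{2r}\rho(\Gamma_{[i_1\dots i_k]})\otimes\rho(\Gamma_{[i_1\dots i_k]})$, where $\Gamma_{[i_1\dots i_k]}=\frac1{k!}\sum_{\sigma\in S_k}\operatorname{sgn}(\sigma)\,\Gamma_{i_{\sigma(1)}}\cdots\Gamma_{i_{\sigma(k)}}$ (so $I_0$ is the identity). Define polynomials $I_{2k}(x)$, $k\ge0$, by $I_0(x)=1$, $I_2(x)=-32(r-1)x$ and, for $k\ge 1$, $$I_{2k+2}(x)=I_{2k}(x)I_2(x)-8k(r-k)I_{2k}(x)-4k(2k-1)(r+1-k)(2r+1-2k)I_{2k-2}(x).$$ The characteristic identity of an operator $T$ is the relation $p(T)=0$ in which $p$ is, up to a nonzero constant factor, the product of $x-\mu$ over the distinct eigenvalues $\mu$ of $T$; its degree is the smallest among all nonzero polynomials annihilating $T$. Then $I_{2k}(x)$ has degree $k$ and $I_{2k}(\widehat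 C_\rho)=I_{2k}$ for all $k\ge 0$, and for each $\epsilon=\pm1$ the following hold. If $r$ is even, the characteristic identities of $\widehat C_{\epsilon,-\epsilon}$ and $\widehat C_{\epsilon,\epsilon}$ are, respectively, $$I_r(\widehat C_{\epsilon,-\epsilon})=0,\qquad I_{r+2}(\widehat C_{\epsilon,\epsilon})-r(r^2-1)(r+2)\,I_{r-2}(\widehat C_{\epsilon,\epsilon})=0,$$ of degrees $\frac r2$ and $\frac r2+1$. If $r$ is odd, the characteristic identities of $\widehat C_{\epsilon,-\epsilon}$ and $\widehat C_{\epsilon,\epsilon}$ are, respectively, $$I_{r+1}(\widehat C_{\epsilon,-\epsilon})-r(r+1)\,I_{r-1}(\widehat C_{\epsilon,-\epsilon})=0,\qquad I_{r+1}(\widehat C_{\epsilon,\epsilon})+r(r+1)\,I_{r-1}(\widehat C_{\epsilon,\epsilon})=0,$$ both of degree $\frac{r+1}2$. -/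

import Mathlib

open scoped TensorProduct

attribute [local instance 100] LieRing.ofAssociativeRing

noncomputable section

namespace SpinorCasimir

/-! ### The split Casimir operator of a Lie algebra -/

section General

variable {𝔤 : Type*} [LieRing 𝔤] [LieAlgebra ℂ 𝔤]
variable {ι : Type*}

/-- The components `g_{AB} = tr (ad X_A ∘ ad X_B)` of the Cartan-Killing metric in a basis `X_A`. -/
def killingMetric (b : Module.Basis ι ℂ 𝔤) : Matrix ι ι ℂ :=
  Matrix.of fun A B => killingForm ℂ 𝔤 (b A) (b B)

/-- The image `∑_{A,B} g^{AB} φ(X_A) ⊗ ψ(X_B)` of the split Casimir operator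
`∑_{A,B} g^{AB} X_A ⊗ X_B` under a pair of representations (of which only linearity matters here);
`g^{AB}` is the inverse of the matrix `g_{AB}`. -/
def splitCasimir [Fintype ι] [DecidableEq ι] (b : Module.Basis ι ℂ 𝔤)
    {V W : Type*} [AddCommGroup V] [Module ℂ V] [AddCommGroup W] [Module ℂ W]
    (φ : 𝔤 →ₗ[ℂ] Module.End ℂ V) (ψ : 𝔤 →ₗ[ℂ] Module.End ℂ W) :
    Module.End ℂ (V ⊗[ℂ] W) :=
  ∑ A, ∑ B, (killingMetric b)⁻¹ A B • TensorProduct.map (φ (b A)) (ψ (b B))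

end General

/-- `p(T) = 0` is the characteristic identity of `T`: up to a nonzero factor, `p` is the product of
`X - μ` over the distinct eigenvalues `μ` of `T`, it annihilates `T`, and no nonzero polynomial
annihilating `T` has smaller degree. -/
structure IsCharacteristicIdentity {W : Type*} [AddCommGroup W] [Module ℂ W]
    (T : Module.End ℂ W) (p : Polynomial ℂ) : Prop where
  eq_prod : ∃ (c : ℂ) (S : Finset ℂ), c ≠ 0 ∧ (∀ μ : ℂ, μ ∈ S ↔ T.HasEigenvalue μ) ∧
    p = Polynomial.C c * ∏ μ ∈ S, (Polynomial.X - Polynomial.C μ)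
  annihilates : Polynomial.aeval T p = 0
  minimal : ∀ q : Polynomial ℂ, q ≠ 0 → Polynomial.aeval T q = 0 → p.natDegree ≤ q.natDegree

/-! ### The Clifford algebra `Cl_{2r}` and `so_{2r}` -/

/-- The quadratic form `∑ x_i ^ 2` on `ℂ ^ (2r)`. -/
def quadForm (r : ℕ) : QuadraticForm ℂ (Fin (2 * r) → ℂ) :=
  QuadraticMap.weightedSumSquares ℂ fun _ => (1 : ℂ)

/-- The complex Clifford algebra, with generators satisfying `Γ_i Γ_j + Γ_j Γ_i = 2 δ_{ij}`. -/
abbrev Cl (r : ℕ) : Type := CliffordAlgebra (quadForm r)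

/-- The generators `Γ_i`. -/
def gamma (r : ℕ) (i : Fin (2 * r)) : Cl r :=
  CliffordAlgebra.ι (quadForm r) (Pi.single i 1)

/-- The antisymmetrised products `Γ_{[i_1 … i_k]}`; for `k = 0` this is the unit. -/
def gammaAntisymm (r k : ℕ) (i : Fin k → Fin (2 * r)) : Cl r :=
  ((k.factorial : ℂ)⁻¹) • ∑ σ : Equiv.Perm (Fin k),
    ((Equiv.Perm.sign σ : ℤ) : ℂ) • (List.ofFn fun a => gamma r (i (σ a))).prod

/-- `Γ_{2r+1} = (-i)^r Γ_1 ⋯ Γ_{2r}`. -/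
def gammaTop (r : ℕ) : Cl r :=
  ((-Complex.I) ^ r) • (List.ofFn (gamma r)).prod

/-- The Lie algebra `so_{2r}` of complex skew-symmetric matrices. -/
abbrev so (r : ℕ) : LieSubalgebra ℂ (Matrix (Fin (2 * r)) (Fin (2 * r)) ℂ) :=
  LieAlgebra.Orthogonal.so (Fin (2 * r)) ℂ

/-- The embedding of `so_{2r}` into `Cl_{2r}`, which sends `M_{ij} = e_{ij} - e_{ji}` to
`[Γ_i, Γ_j] / 4`; note that `A = 1/2 ∑_{i,j} A_{ij} M_{ij}` for skew-symmetric `A`. -/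
def soToCl (r : ℕ) : so r →ₗ[ℂ] Cl r where
  toFun A := (1 / 2 : ℂ) • ∑ i, ∑ j, A.1 i j •
    ((1 / 4 : ℂ) • (gamma r i * gamma r j - gamma r j * gamma r i))
  map_add' A B := by
    have h : ∀ i j, (A + B).1 i j = A.1 i j + B.1 i j := fun _ _ => rfl
    simp only [h, add_smul, Finset.sum_add_distrib, smul_add]
  map_smul' c A := by
    have h : ∀ i j, (c • A).1 i j = c * A.1 i j := fun _ _ => rfl
    simp only [h, mul_smul, ← Finset.smul_sum, RingHom.id_apply, smul_comm c (1 / 2 : ℂ)]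

/-! ### Spinor representations

`V` is a module over `Cl_{2r}`; in the theorem it is simple, i.e. it carries the irreducible
representation `ρ`. -/

section Spinor

variable (r : ℕ) (V : Type*) [AddCommGroup V] [Module ℂ V] [Module (Cl r) V]
  [IsScalarTower ℂ (Cl r) V]

/-- The representation `ρ` of the Clifford algebra on its module `V`. -/
def rho : Cl r →ₐ[ℂ] Module.End ℂ V := Algebra.lsmul ℂ ℂ V

/-- The restriction of `ρ` to `so_{2r}`. -/
def spinorRep : so r →ₗ[ℂ] Module.End ℂ V := (rho r V).toLinearMap ∘ₗ soToCl r

/-- The operator `I_k = ∑ Γ_{[i_1 … i_k]} ⊗ Γ_{[i_1 … i_k]}` on `V ⊗ V`, summed over all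
`i_1, …, i_k`. -/
def invariantI (k : ℕ) : Module.End ℂ (V ⊗[ℂ] V) :=
  ∑ i : Fin k → Fin (2 * r),
    TensorProduct.map (rho r V (gammaAntisymm r k i)) (rho r V (gammaAntisymm r k i))

/-- The split Casimir operator of `so_{2r}` in the representation `ρ ⊗ ρ`. -/
def casimirRho {ι : Type*} [Fintype ι] [DecidableEq ι] (b : Module.Basis ι ℂ (so r)) :
    Module.End ℂ (V ⊗[ℂ] V) :=
  splitCasimir b (spinorRep r V) (spinorRep r V)

/-- The chiral projectors `P_ε = (1 + ε ρ(Γ_{2r+1})) / 2`, `ε = ±1`. -/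
def chiralProj (ε : ℤˣ) : Module.End ℂ V :=
  (1 / 2 : ℂ) • (1 + ((ε : ℤ) : ℂ) • rho r V (gammaTop r))

/-- `P_{εε'} = P_ε ⊗ P_ε'`. -/
def chiralProj₂ (ε ε' : ℤˣ) : Module.End ℂ (V ⊗[ℂ] V) :=
  TensorProduct.map (chiralProj r V ε) (chiralProj r V ε')

/-- The representation space of `Δ_ε ⊗ Δ_ε'`, as the image of `P_{εε'}` in `V ⊗ V`. -/
abbrev ChiralSpace (ε ε' : ℤˣ) : Submodule ℂ (V ⊗[ℂ] V) :=
  LinearMap.range (chiralProj₂ r V ε ε')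

/-- `Ĉ_{εε'} = P_{εε'} Ĉ_ρ`, as an operator on the space of `Δ_ε ⊗ Δ_ε'`. -/
def casimirChiral {ι : Type*} [Fintype ι] [DecidableEq ι] (b : Module.Basis ι ℂ (so r))
    (ε ε' : ℤˣ) : Module.End ℂ (ChiralSpace r V ε ε') :=
  (chiralProj₂ r V ε ε').rangeRestrict ∘ₗ casimirRho r V b ∘ₗ (ChiralSpace r V ε ε').subtype

end Spinor

/-- The polynomial `I_{2k}(x)` of degree `k` that expresses the invariant `I_{2k}` through the
split Casimir operator: `I_0 = 1`, `I_2 = -32 (r - 1) x` and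
`I_{2k} I_2 = I_{2k+2} + 8k(r-k) I_{2k} + 4k(2k-1)(r+1-k)(2r+1-2k) I_{2k-2}`. -/
def polyI (r : ℕ) : ℕ → Polynomial ℂ
  | 0 => 1
  | 1 => Polynomial.C (-32 * ((r : ℂ) - 1)) * Polynomial.X
  | k + 2 =>
    let κ : ℂ := (k : ℂ) + 1
    polyI r (k + 1) * (Polynomial.C (-32 * ((r : ℂ) - 1)) * Polynomial.X)
      - Polynomial.C (8 * κ * ((r : ℂ) - κ)) * polyI r (k + 1)
      - Polynomial.C (4 * κ * (2 * κ - 1) * ((r : ℂ) + 1 - κ) * (2 * (r : ℂ) + 1 - 2 * κ))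
        * polyI r k

end SpinorCasimir

end

/-!
The operators `aᵢ = ρ(Γᵢ) ⊗ ρ(Γᵢ)` on `V ⊗ V` commute, because the two signs from anticommuting the
generators cancel, and they are involutions. Everything is expressed through them.

* Since `Γ_{[i₁ … i_k]}` is the ordered product for distinct indices and zero otherwise, the
  invariant `I_k` is `k!` times the `k`-th elementary symmetric function of the `aᵢ`
  (`invariantI_eq`). The generating function `∏ (1 + aᵢ X)` gives the recursion of these functions
  (`sum_mul_elemSymm`), and two steps of it are the recursion of the polynomials `I_{2k}(x)`
  (`tupleSum_mul_tupleSum_two`).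
* The Killing form of `so_n` is `(n - 2) tr (X Y)` (`killingForm_so`), whence
  `-32 (r - 1) Ĉ_ρ = I₂ = (∑ aᵢ)² - 2r` (`smul_casimirRho`). Thus `I_{2k}(Ĉ_ρ) = I_{2k}`
  (`aeval_casimirRho`).
* On the image of `P_{εε'}` the product of all `aᵢ` is the sign `(-1)^r ε ε'`. Multiplication by it
  exchanges complementary elementary symmetric functions, so `I_k` and `I_{2r-k}` are proportional
  there (`invariantI_apply_of_mem`); near `k = r` these relations are the asserted identities.
* It remains to find as many eigenvalues as the degree of the identity. Every sign pattern is a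
  joint eigenvalue of the `aᵢ`, since `ρ(Γᵢ Γ_{2r+1}) ⊗ 1` changes the sign at the index `i` only
  (`exists_joint_eigenvector`). A joint eigenvector with `r - j` minus signs projects to a nonzero
  vector of the image of `P_{εε'}`, `ε ε' = (-1)^j`, on which `(∑ aᵢ)² = (2j)²`
  (`hasEigenvalue_casimirChiral`). The values for `0 ≤ j ≤ r` of the right parity are distinct, and
  their number is the degree (`isCharacteristicIdentity_casimirChiral`).
-/

open scoped TensorProduct

noncomputable section

namespace SpinorCasimir

/-! ### Elementary symmetric functions of commuting involutions -/

section Symmetric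

open Polynomial Finset

universe u

variable {ι : Type*} [Fintype ι] [DecidableEq ι]

/-- The sum of `a (i 0) * ⋯ * a (i (k - 1))` over all injective `k`-tuples of indices. For a
commuting family this is `k!` times the `k`-th elementary symmetric function; the ring is not
assumed commutative, so that the definition applies to operators. -/
def tupleSum {R : Type*} [Ring R] (a : ι → R) (k : ℕ) : R :=
  ∑ i : Fin k → ι with Function.Injective i, (List.ofFn fun l => a (i l)).prod

theorem map_tupleSum {R S : Type*} [Ring R] [Ring S] (f : R →+* S) (a : ι → R) (k : ℕ) :
    f (tupleSum a k) = tupleSum (fun i => f (a i)) k := by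
  simp only [tupleSum, map_sum, map_list_prod, List.map_ofFn, Function.comp_def]

/-- The `k`-th elementary symmetric function of a finite family. -/
def elemSymm {ι A : Type*} [Fintype ι] [CommRing A] (a : ι → A) (k : ℕ) : A :=
  ∑ S ∈ powersetCard k (univ : Finset ι), ∏ i ∈ S, a i

theorem coeff_prod_one_add {ι A : Type*} [Fintype ι] [CommRing A] (a : ι → A) (k : ℕ) :
    (∏ i, (1 + C (a i) * X) : A[X]).coeff k = elemSymm a k := by
  classical
  rw [prod_one_add, finsetSum_coeff, elemSymm, powersetCard_eq_filter, sum_filter]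
  refine sum_congr rfl fun S _ => ?_
  rw [prod_mul_distrib, prod_const, ← map_prod, coeff_C_mul, coeff_X_pow]
  simp [eq_comm]

/-- Each `k`-element set is the image of exactly `k!` injective tuples. -/
theorem tupleSum_eq {A : Type*} [CommRing A] (a : ι → A) (k : ℕ) :
    tupleSum a k = k.factorial * elemSymm a k := by
  have key : ∀ S ∈ powersetCard k (univ : Finset ι),
      ∑ i ∈ (univ.filter fun i : Fin k → ι => Function.Injective i) with univ.image i = S,
        (List.ofFn fun l => a (i l)).prod = k.factorial * ∏ i ∈ S, a i := by
    intro S hS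
    have hcard : #S = k := (mem_powersetCard.1 hS).2
    have hconst : ∀ i ∈ ((univ.filter fun i : Fin k → ι => Function.Injective i).filter
        fun i => univ.image i = S), (List.ofFn fun l => a (i l)).prod = ∏ j ∈ S, a j := by
      intro i hi
      simp only [mem_filter, mem_univ, true_and] at hi
      rw [List.prod_ofFn, ← hi.2, prod_image hi.1.injOn]
    rw [sum_congr rfl hconst, sum_const, nsmul_eq_mul]
    congr 2
    have e : Fin k ≃ S := (Fintype.equivFinOfCardEq (by simpa using hcard)).symm
    rw [← Fintype.card_fin k, ← Fintype.card_equiv e, Fintype.card_fin, ← card_univ]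
    refine (card_bij (fun (f : Fin k ≃ S) _ l => (f l : ι)) ?_ ?_ ?_).symm
    · intro f _
      simp only [mem_filter, mem_univ, true_and]
      refine ⟨Subtype.val_injective.comp f.injective, ?_⟩
      ext x
      simp only [mem_image, mem_univ, true_and]
      exact ⟨fun ⟨l, hl⟩ => hl ▸ (f l).2, fun hx => ⟨f.symm ⟨x, hx⟩, by simp⟩⟩
    · intro f _ g _ h
      ext l
      exact congrFun h l
    · intro i hi
      simp only [mem_filter, mem_univ, true_and] at hi
      have hm : ∀ l, i l ∈ S := fun l => hi.2 ▸ mem_image_of_mem i (mem_univ l)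
      refine ⟨Equiv.ofBijective (fun l => ⟨i l, hm l⟩)
        ((Fintype.bijective_iff_injective_and_card _).2
          ⟨fun x y h => hi.1 (by simpa using h), by simp [hcard]⟩), mem_univ _, rfl⟩
  rw [tupleSum, elemSymm, mul_sum, ← sum_congr rfl key]
  refine (sum_fiberwise_of_maps_to (fun i hi => ?_) _).symm
  simp only [mem_filter, mem_univ, true_and] at hi
  simp [mem_powersetCard, card_image_of_injective _ hi]

/-- The recursion is the coefficientwise form of `(1 - X²) E' = (∑ aᵢ - n X) E`, where
`E = ∏ (1 + aᵢ X)` is the generating function; it uses `(1 + aᵢ X)(1 - aᵢ X) = 1 - X²`. -/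
theorem sum_mul_elemSymm {ι A : Type*} [Fintype ι] [CommRing A] {a : ι → A}
    (ha : ∀ i, a i * a i = 1) (k : ℕ) :
    (∑ i, a i) * elemSymm a (k + 1) =
      (k + 2) * elemSymm a (k + 2) + ((Fintype.card ι : A) - k) * elemSymm a k := by
  classical
  set E : A[X] := ∏ i, (1 + C (a i) * X) with hE
  have hder : (1 - X ^ 2) * derivative E = (C (∑ i, a i) - (Fintype.card ι : A[X]) * X) * E := by
    have hi : ∀ i ∈ (univ : Finset ι), (1 - X ^ 2) *
        ((∏ j ∈ univ.erase i, (1 + C (a j) * X)) * derivative (1 + C (a i) * X)) =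
        (C (a i) - X) * E := by
      intro i _
      have h1 : (C (a i) * C (a i) : A[X]) = 1 := by rw [← C_mul, ha i, C_1]
      rw [hE, ← mul_prod_erase univ _ (mem_univ i)]
      simp only [derivative_add, derivative_one, derivative_mul, derivative_C, derivative_X,
        zero_mul, zero_add, mul_one]
      linear_combination -X * (∏ j ∈ univ.erase i, (1 + C (a j) * X)) * h1
    rw [hE, derivative_prod_finset, mul_sum, sum_congr rfl hi, ← sum_mul, sum_sub_distrib,
      map_sum, sum_const, card_univ, nsmul_eq_mul]
  have h := congrArg (fun p => coeff p (k + 1)) hder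
  have hE' : ∀ m, E.coeff m = elemSymm a m := coeff_prod_one_add a
  rcases k with _ | k
  · simp only [sub_mul, one_mul, coeff_sub, coeff_C_mul, mul_assoc, coeff_X_mul, coeff_derivative,
      hE', coeff_natCast_mul, coeff_X_pow_mul'] at h
    norm_num at h ⊢
    linear_combination -h
  · simp only [sub_mul, one_mul, coeff_sub, coeff_C_mul, mul_assoc, coeff_X_mul, coeff_derivative,
      hE', coeff_natCast_mul, coeff_X_pow_mul', show k + 1 + 1 - 2 = k from rfl] at h
    norm_num at h ⊢
    linear_combination -h

/-- Multiplication by `∏ aᵢ` replaces each product over `S` by the one over the complement. -/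
theorem prod_mul_elemSymm {ι A : Type*} [Fintype ι] [CommRing A] {a : ι → A}
    (ha : ∀ i, a i * a i = 1) {k l : ℕ} (h : k + l = Fintype.card ι) :
    (∏ i, a i) * elemSymm a k = elemSymm a l := by
  classical
  rw [elemSymm, elemSymm, mul_sum]
  refine sum_bij' (fun S _ => Sᶜ) (fun S _ => Sᶜ) ?_ ?_ (by simp) (by simp) ?_
  · intro S hS
    rw [mem_powersetCard_univ] at hS ⊢
    rw [card_compl]; omega
  · intro S hS
    rw [mem_powersetCard_univ] at hS ⊢
    rw [card_compl]; omega
  · intro S _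
    rw [← prod_mul_prod_compl S a, mul_right_comm, ← prod_mul_distrib]
    simp [ha]

theorem tupleSum_zero {R : Type*} [Ring R] (a : ι → R) : tupleSum a 0 = 1 := by
  simp [tupleSum, Function.injective_of_subsingleton]

theorem tupleSum_one {R : Type*} [Ring R] (a : ι → R) : tupleSum a 1 = ∑ i, a i := by
  rw [tupleSum, filter_true_of_mem fun i _ => Function.injective_of_subsingleton i]
  simp only [List.ofFn_succ, List.ofFn_zero, List.prod_cons, List.prod_nil, mul_one]
  exact Fintype.sum_equiv (Equiv.funUnique (Fin 1) ι) _ _ fun i => rfl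

/-- A commuting family lies in a commutative subalgebra, so that polynomial identities between its
members may be proved in a commutative ring. -/
theorem exists_commRing_of_commute {ι : Type*} {R : Type u} [Ring R] [Algebra ℂ R] (a : ι → R)
    (hc : ∀ i j, a i * a j = a j * a i) :
    ∃ (A : Type u) (_ : CommRing A) (f : A →+* R) (a' : ι → A),
      Function.Injective f ∧ ∀ i, f (a' i) = a i := by
  have : IsMulCommutative (Algebra.adjoin ℂ (Set.range a)) := by
    refine Algebra.isMulCommutative_adjoin ℂ ?_
    rintro _ ⟨i, rfl⟩ _ ⟨j, rfl⟩
    exact hc i j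
  exact ⟨Algebra.adjoin ℂ (Set.range a), { mul_comm := mul_comm' },
    (Algebra.adjoin ℂ (Set.range a)).val.toRingHom,
    fun i => ⟨a i, Algebra.subset_adjoin ⟨i, rfl⟩⟩, Subtype.val_injective, fun i => rfl⟩

theorem sum_mul_tupleSum {A : Type*} [CommRing A] {a : ι → A} (ha : ∀ i, a i * a i = 1) (k : ℕ) :
    (∑ i, a i) * tupleSum a (k + 1) =
      tupleSum a (k + 2) + (k + 1) * ((Fintype.card ι : A) - k) * tupleSum a k := by
  simp only [tupleSum_eq, Nat.factorial_succ]
  push_cast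
  linear_combination ((k : A) + 1) * (k.factorial : A) * sum_mul_elemSymm ha k

theorem tupleSum_two_of_commRing {A : Type*} [CommRing A] {a : ι → A} (ha : ∀ i, a i * a i = 1) :
    tupleSum a 2 = (∑ i, a i) * (∑ i, a i) - (Fintype.card ι : A) := by
  have h := sum_mul_tupleSum ha 0
  simp only [zero_add, tupleSum_one, tupleSum_zero] at h
  rw [h]; simp

theorem tupleSum_two {R : Type*} [Ring R] [Algebra ℂ R] {a : ι → R}
    (hc : ∀ i j, a i * a j = a j * a i) (ha : ∀ i, a i * a i = 1) :
    tupleSum a 2 = (∑ i, a i) * (∑ i, a i) - (Fintype.card ι : R) := by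
  obtain ⟨A, _, f, a', hf, ha'⟩ := exists_commRing_of_commute a hc
  obtain rfl : (fun i => f (a' i)) = a := funext ha'
  simpa [map_tupleSum] using
    congrArg f (tupleSum_two_of_commRing (a := a') (fun i => hf (by simpa using ha i)))

/-- The recursion behind the polynomials `polyI`, with `k + 1` in the place of `k`: two steps of
`sum_mul_tupleSum`, after `(∑ aᵢ)²` has been expressed through `tupleSum a 2`. -/
theorem tupleSum_mul_tupleSum_two {r : ℕ} (hr : Fintype.card ι = 2 * r) {R : Type*} [Ring R]
    [Algebra ℂ R] {a : ι → R} (hc : ∀ i j, a i * a j = a j * a i) (ha : ∀ i, a i * a i = 1)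
    (k : ℕ) :
    tupleSum a (2 * k + 2) * tupleSum a 2 = tupleSum a (2 * k + 4) +
      8 * ((k : R) + 1) * ((r : R) - (k + 1)) * tupleSum a (2 * k + 2) +
      4 * ((k : R) + 1) * (2 * (k + 1) - 1) * ((r : R) + 1 - (k + 1)) *
        (2 * r + 1 - 2 * (k + 1)) * tupleSum a (2 * k) := by
  obtain ⟨A, _, f, a', hf, ha'⟩ := exists_commRing_of_commute a hc
  obtain rfl : (fun i => f (a' i)) = a := funext ha'
  have ha2 : ∀ i, a' i * a' i = 1 := fun i => hf (by simpa using ha i)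
  have h1 := sum_mul_tupleSum ha2 (2 * k + 2)
  have h2 := sum_mul_tupleSum ha2 (2 * k + 1)
  have h3 := sum_mul_tupleSum ha2 (2 * k)
  have h0 := tupleSum_two_of_commRing ha2
  rw [hr] at h0 h1 h2 h3
  push_cast at h0 h1 h2 h3
  have : tupleSum a' (2 * k + 2) * tupleSum a' 2 = tupleSum a' (2 * k + 4) +
      8 * ((k : A) + 1) * ((r : A) - (k + 1)) * tupleSum a' (2 * k + 2) +
      4 * ((k : A) + 1) * (2 * (k + 1) - 1) * ((r : A) + 1 - (k + 1)) *
        (2 * r + 1 - 2 * (k + 1)) * tupleSum a' (2 * k) := by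
    linear_combination tupleSum a' (2 * k + 2) * h0 + h1 + (∑ i, a' i) * h2 +
      (2 * (k : A) + 2) * (2 * r - (2 * k + 1)) * h3
  simpa [map_tupleSum, map_ofNat f 8, map_ofNat f 4, map_ofNat f 2] using congrArg f this

/-- Complementary elementary symmetric functions are exchanged by `∏ aᵢ`. -/
theorem tupleSum_mul_prod {n : ℕ} {R : Type*} [Ring R] [Algebra ℂ R] {a : Fin n → R}
    (hc : ∀ i j, a i * a j = a j * a i) (ha : ∀ i, a i * a i = 1) {k l : ℕ} (h : k + l = n) :
    (l.factorial : R) * (tupleSum a k * (List.ofFn a).prod) =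
      (k.factorial : R) * tupleSum a l := by
  obtain ⟨A, _, f, a', hf, ha'⟩ := exists_commRing_of_commute a hc
  obtain rfl : (fun i => f (a' i)) = a := funext ha'
  have h := prod_mul_elemSymm (a := a') (fun i => hf (by simpa using ha i))
    (h.trans (Fintype.card_fin n).symm)
  have h2 : (List.ofFn fun i => f (a' i)).prod = f (∏ i, a' i) := by
    rw [← List.prod_ofFn, map_list_prod, List.map_ofFn]; rfl
  rw [← map_tupleSum, ← map_tupleSum, h2]
  have : (l.factorial : A) * (tupleSum a' k * ∏ i, a' i) =
      (k.factorial : A) * tupleSum a' l := by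
    simp only [tupleSum_eq]
    linear_combination (l.factorial : A) * (k.factorial : A) * h
  simpa using congrArg f this

end Symmetric

/-! ### Products of anticommuting elements -/

section Anticommuting

variable {R : Type*} [Ring R]

/-- Exchanging two anticommuting neighbours changes the sign of an ordered product. -/
theorem prod_ofFn_comp_swap {k : ℕ} (f : Fin (k + 1) → R) (j : Fin k)
    (h : f j.castSucc * f j.succ = -(f j.succ * f j.castSucc)) :
    (List.ofFn fun l => f (Equiv.swap j.castSucc j.succ l)).prod = -(List.ofFn f).prod := by
  induction k with
  | zero => exact j.elim0
  | succ k ih =>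
    cases j using Fin.cases with
    | zero =>
      have h2 : ∀ l : Fin k, Equiv.swap (0 : Fin (k + 2)) 1 l.succ.succ = l.succ.succ := fun l =>
        Equiv.swap_apply_of_ne_of_ne (Fin.succ_ne_zero _)
          (fun e => Fin.succ_ne_zero l (Fin.succ_injective _ e))
      simp only [Fin.castSucc_zero, Fin.succ_zero_eq_one] at h ⊢
      simp only [List.ofFn_succ, List.prod_cons, Fin.succ_zero_eq_one, Equiv.swap_apply_left,
        Equiv.swap_apply_right, h2, ← mul_assoc, h, neg_mul, neg_neg]
    | succ j =>
      have h0 : Equiv.swap j.succ.castSucc j.succ.succ (0 : Fin (k + 2)) = 0 :=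
        Equiv.swap_apply_of_ne_of_ne (by simp [Fin.ext_iff]) (Fin.succ_ne_zero _).symm
      have hs : ∀ l : Fin (k + 1), Equiv.swap j.succ.castSucc j.succ.succ l.succ =
          (Equiv.swap j.castSucc j.succ l).succ := fun l =>
        ((Fin.succ_injective _).swap_apply j.castSucc j.succ l)
      rw [List.ofFn_succ, List.ofFn_succ (f := f), List.prod_cons, List.prod_cons, h0,
        ← mul_neg, ← ih (fun l => f l.succ) j h]
      simp only [hs]

/-- Reordering a product of pairwise anticommuting elements multiplies it by the sign of the
permutation. -/
theorem prod_ofFn_comp_perm {k : ℕ} (f : Fin k → R)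
    (h : ∀ i j, i ≠ j → f i * f j = -(f j * f i)) (σ : Equiv.Perm (Fin k)) :
    (List.ofFn fun l => f (σ l)).prod = ((Equiv.Perm.sign σ : ℤ) : R) * (List.ofFn f).prod := by
  cases k with
  | zero => simp [Subsingleton.elim σ 1]
  | succ k =>
    have hσ : σ ∈ Submonoid.closure
        (Set.range fun i : Fin k => Equiv.swap i.castSucc i.succ) := by
      rw [Equiv.Perm.mclosure_swap_castSucc_succ]; trivial
    induction hσ using Submonoid.closure_induction_right with
    | one => simp
    | mul_right σ _ τ hτ ih =>
      obtain ⟨j, rfl⟩ := hτ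
      have hne : j.castSucc ≠ j.succ := (Fin.castSucc_lt_succ).ne
      have := prod_ofFn_comp_swap (fun l => f (σ l)) j (h _ _ (σ.injective.ne hne))
      simp only [Equiv.Perm.mul_apply]
      rw [this, ih, Equiv.Perm.sign_mul, Equiv.Perm.sign_swap hne]
      simp

variable {ι : Type*} {g : ι → R}

theorem mul_prod_map (h : ∀ i j, i ≠ j → g i * g j = -(g j * g i)) (i : ι) {l : List ι}
    (hl : i ∉ l) : g i * (l.map g).prod = (-1) ^ l.length * ((l.map g).prod * g i) := by
  induction l with
  | nil => simp
  | cons j l ih =>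
    rw [List.mem_cons, not_or] at hl
    rw [List.map_cons, List.prod_cons, ← mul_assoc, h i j hl.1, neg_mul, mul_assoc, ih hl.2,
      List.length_cons, pow_succ, ← ((Commute.neg_one_left (g j)).pow_left _).left_comm]
    simp [mul_assoc]

/-- Compared with `mul_prod_map`, the sign is opposite: `g i` commutes with its own occurrence in
the product. -/
theorem mul_prod_map_of_mem (h : ∀ i j, i ≠ j → g i * g j = -(g j * g i)) (i : ι) {l : List ι}
    (hl : i ∈ l) (hn : l.Nodup) :
    g i * (l.map g).prod = -((-1) ^ l.length * ((l.map g).prod * g i)) := by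
  induction l with
  | nil => simp at hl
  | cons j l ih =>
    classical
    rw [List.nodup_cons] at hn
    rw [List.map_cons, List.prod_cons, List.length_cons, pow_succ]
    by_cases hij : i = j
    · subst hij
      rw [mul_prod_map h i hn.1, ← ((Commute.neg_one_left (g i)).pow_left _).left_comm,
        ← mul_assoc (g i), mul_prod_map h i hn.1]
      simp [mul_assoc]
    · have hl' : i ∈ l := by simpa [hij] using hl
      rw [← mul_assoc, h i j hij, neg_mul, mul_assoc, ih hl' hn.2, mul_neg,
        ← ((Commute.neg_one_left (g j)).pow_left _).left_comm]
      simp [mul_assoc]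

/-- Reversing one of the two factors takes `l.length.choose 2` exchanges; the product then
telescopes. -/
theorem prod_map_mul_self (h : ∀ i j, i ≠ j → g i * g j = -(g j * g i))
    (h1 : ∀ i, g i * g i = 1) {l : List ι} (hn : l.Nodup) :
    (l.map g).prod * (l.map g).prod = (-1) ^ (l.length.choose 2) := by
  induction l with
  | nil => simp
  | cons i l ih =>
    rw [List.nodup_cons] at hn
    have h2 := mul_prod_map h i hn.1
    have h3 : (l.map g).prod * g i = (-1) ^ l.length * (g i * (l.map g).prod) := by
      rw [h2, ← mul_assoc, ← pow_add, Even.neg_one_pow ⟨_, rfl⟩, one_mul]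
    rw [List.map_cons, List.prod_cons, mul_assoc, ← mul_assoc (l.map g).prod, h3, mul_assoc,
      ← ((Commute.neg_one_left (g i)).pow_left _).left_comm, mul_assoc, ih hn.2, ← mul_assoc (g i),
      h1, one_mul, ← pow_add, List.length_cons, Nat.choose_succ_succ' l.length 1,
      Nat.choose_one_right]

end Anticommuting

/-! ### The generators of the Clifford algebra -/

section Clifford

variable (r : ℕ)

theorem quadForm_apply (x : Fin (2 * r) → ℂ) : quadForm r x = ∑ i, x i * x i := by
  simp [quadForm, QuadraticMap.weightedSumSquares_apply]

theorem gamma_mul_self (i : Fin (2 * r)) : gamma r i * gamma r i = 1 := by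
  rw [gamma, CliffordAlgebra.ι_sq_scalar, quadForm_apply]
  simp [Pi.single_apply]

theorem gamma_mul_gamma (i j : Fin (2 * r)) (h : i ≠ j) :
    gamma r i * gamma r j = -(gamma r j * gamma r i) := by
  rw [eq_neg_iff_add_eq_zero, gamma, gamma, CliffordAlgebra.ι_mul_ι_add_swap, QuadraticMap.polar]
  simp only [quadForm_apply, Pi.add_apply, add_mul, mul_add, Finset.sum_add_distrib]
  simp [Pi.single_apply, h, h.symm]

theorem gammaAntisymm_of_injective {k : ℕ} {i : Fin k → Fin (2 * r)} (hi : Function.Injective i) :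
    gammaAntisymm r k i = (List.ofFn fun l => gamma r (i l)).prod := by
  have h : ∀ σ : Equiv.Perm (Fin k), ((Equiv.Perm.sign σ : ℤ) : ℂ) •
      (List.ofFn fun a => gamma r (i (σ a))).prod = (List.ofFn fun l => gamma r (i l)).prod := by
    intro σ
    rw [prod_ofFn_comp_perm (fun l => gamma r (i l))
      (fun a b hab => gamma_mul_gamma r _ _ (hi.ne hab)) σ]
    rcases Int.units_eq_one_or (Equiv.Perm.sign σ) with h | h <;> simp [h]
  rw [gammaAntisymm, Finset.sum_congr rfl fun σ _ => h σ, Finset.sum_const, Finset.card_univ,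
    Fintype.card_perm, Fintype.card_fin, ← Nat.cast_smul_eq_nsmul ℂ, smul_smul,
    inv_mul_cancel₀ (Nat.cast_ne_zero.2 k.factorial_ne_zero), one_smul]

theorem gammaAntisymm_of_not_injective {k : ℕ} {i : Fin k → Fin (2 * r)}
    (hi : ¬ Function.Injective i) : gammaAntisymm r k i = 0 := by
  simp only [Function.Injective, not_forall] at hi
  obtain ⟨a, b, hab, hne⟩ := hi
  -- Exchanging two positions with equal indices keeps each product and negates each sign.
  set F : Equiv.Perm (Fin k) → Cl r := fun σ => ((Equiv.Perm.sign σ : ℤ) : ℂ) •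
    (List.ofFn fun c => gamma r (i (σ c))).prod with hF
  have h : ∀ σ, F (Equiv.swap a b * σ) = -F σ := by
    intro σ
    have hi' : ∀ c, i (Equiv.swap a b c) = i c := by
      intro c
      rw [Equiv.swap_apply_def]
      split_ifs with h1 h2
      · rw [h1, hab]
      · rw [h2, hab]
      · rfl
    simp [hF, Equiv.Perm.sign_swap hne, hi']
  have h2 : ∑ σ, F σ = -∑ σ, F σ := by
    rw [← Finset.sum_neg_distrib, ← Equiv.sum_comp (Equiv.mulLeft (Equiv.swap a b)) F]
    exact Finset.sum_congr rfl fun σ _ => h σ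
  have h3 : (2 : ℂ) • ∑ σ, F σ = 0 := by
    rw [two_smul]; nth_rewrite 1 [h2]; exact neg_add_cancel _
  rw [gammaAntisymm, (smul_eq_zero.1 h3).resolve_left two_ne_zero, smul_zero]

theorem prod_ofFn_gamma : (List.ofFn (gamma r)).prod =
    ((List.finRange (2 * r)).map (gamma r)).prod := by
  rw [List.ofFn_eq_map]

theorem gamma_mul_gammaTop (i : Fin (2 * r)) :
    gamma r i * gammaTop r = -(gammaTop r * gamma r i) := by
  rw [gammaTop, prod_ofFn_gamma, mul_smul_comm, smul_mul_assoc,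
    mul_prod_map_of_mem (gamma_mul_gamma r) i (List.mem_finRange i) (List.nodup_finRange _)]
  simp [pow_mul]

theorem gammaTop_mul_self : gammaTop r * gammaTop r = 1 := by
  rw [gammaTop, prod_ofFn_gamma, smul_mul_smul_comm,
    prod_map_mul_self (gamma_mul_gamma r) (gamma_mul_self r) (List.nodup_finRange _),
    List.length_finRange]
  have h : (2 * r).choose 2 = r * (2 * r - 1) := by
    rw [Nat.choose_two_right, mul_assoc, Nat.mul_div_cancel_left _ two_pos]
  rcases r with _ | r
  · simp
  have h2 : (-1 : Cl (r + 1)) ^ ((2 * (r + 1)).choose 2) = (-1) ^ (r + 1) := by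
    have h3 : (r + 1) * (2 * (r + 1) - 1) = 2 * ((r + 1) * r) + (r + 1) := by
      rw [show 2 * (r + 1) - 1 = 2 * r + 1 by omega]; ring
    rw [h, h3, pow_add, pow_mul]
    simp
  rw [h2, ← mul_pow]
  simp only [neg_mul_neg, Complex.I_mul_I]
  rw [Algebra.smul_def, map_pow, map_neg, map_one, ← pow_add, Even.neg_one_pow ⟨_, rfl⟩]

end Clifford

/-! ### The Killing form of `so_n` and the split Casimir operator -/

section Casimir

open Matrix

variable {n : Type*} [Fintype n] [DecidableEq n]

theorem trace_end_matrix (T : Module.End ℂ (Matrix n n ℂ)) :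
    LinearMap.trace ℂ _ T = ∑ i, ∑ j, T (Matrix.single i j 1) i j := by
  rw [LinearMap.trace_eq_matrix_trace ℂ (Matrix.stdBasis ℂ n n), Matrix.trace,
    Fintype.sum_prod_type]
  refine Finset.sum_congr rfl fun i _ => Finset.sum_congr rfl fun j _ => ?_
  rw [Matrix.diag_apply, LinearMap.toMatrix_apply, Matrix.stdBasis_eq_single]
  simp [Matrix.stdBasis]

theorem sum_mul_single_mul (A B : Matrix n n ℂ) :
    ∑ i, ∑ j, (A * (Matrix.single i j 1 : Matrix n n ℂ) * B) i j = A.trace * B.trace := by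
  simp [Matrix.mul_apply, Matrix.single_apply, Matrix.trace, Finset.sum_mul_sum, ite_and,
    Finset.sum_ite_eq]

theorem sum_mul_single_transpose_mul (A B : Matrix n n ℂ) :
    ∑ i, ∑ j, (A * (Matrix.single j i 1 : Matrix n n ℂ) * B) i j = (A * Bᵀ).trace := by
  simp [Matrix.mul_apply, Matrix.single_apply, Matrix.trace, ite_and, Finset.sum_ite_eq]

/-- The projection `Z ↦ (Z - Zᵀ) / 2` of all matrices onto the skew-symmetric ones. -/
def skewPart : Matrix n n ℂ →ₗ[ℂ] LieAlgebra.Orthogonal.so n ℂ :=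
  LinearMap.codRestrict (LieAlgebra.Orthogonal.so n ℂ).toSubmodule
    ((1 / 2 : ℂ) • (LinearMap.id - (Matrix.transposeLinearEquiv n n ℂ ℂ).toLinearMap))
    (fun Z => by
      rw [LieSubalgebra.mem_toSubmodule, LieAlgebra.Orthogonal.mem_so]
      simp [← smul_neg])

theorem skewPart_coe (Z : Matrix n n ℂ) :
    (skewPart Z : Matrix n n ℂ) = (1 / 2 : ℂ) • (Z - Zᵀ) := rfl

theorem skewPart_of_mem (Z : LieAlgebra.Orthogonal.so n ℂ) : skewPart (Z : Matrix n n ℂ) = Z := by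
  apply Subtype.ext
  have h := (LieAlgebra.Orthogonal.mem_so _ _ Z.1).1 Z.2
  rw [skewPart_coe, h, sub_neg_eq_add, ← two_smul ℂ, smul_smul]
  norm_num

/-- The trace of `ad X ∘ ad Y` on `so_n` is that of `ad X ∘ ad Y ∘ skewPart` on all matrices. The
latter is a sum of traces of maps `Z ↦ A Z B`, equal to `tr A * tr B`, and `Z ↦ A Zᵀ B`, equal to
`tr (A Bᵀ)`. -/
theorem killingForm_so (X Y : LieAlgebra.Orthogonal.so n ℂ) :
    killingForm ℂ (LieAlgebra.Orthogonal.so n ℂ) X Y =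
      ((Fintype.card n : ℂ) - 2) * (X.1 * Y.1).trace := by
  set incl : LieAlgebra.Orthogonal.so n ℂ →ₗ[ℂ] Matrix n n ℂ :=
    (LieAlgebra.Orthogonal.so n ℂ).toSubmodule.subtype with hincl
  set D : Module.End ℂ (LieAlgebra.Orthogonal.so n ℂ) :=
    LieAlgebra.ad ℂ _ X ∘ₗ LieAlgebra.ad ℂ _ Y with hD
  have h1 : D = (D ∘ₗ skewPart) ∘ₗ incl := by
    ext1 Z
    exact congrArg D (skewPart_of_mem Z).symm
  have h2 : killingForm ℂ (LieAlgebra.Orthogonal.so n ℂ) X Y =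
      LinearMap.trace ℂ _ (incl ∘ₗ D ∘ₗ skewPart) := by
    rw [killingForm_apply_apply]
    exact (congrArg (LinearMap.trace ℂ _) h1).trans
      (LinearMap.trace_comp_comm' incl (D ∘ₗ skewPart))
  have hX := (LieAlgebra.Orthogonal.mem_so _ _ X.1).1 X.2
  have hY := (LieAlgebra.Orthogonal.mem_so _ _ Y.1).1 Y.2
  -- The factors `1` bring every term into the form `A * Z * B` of the two trace formulas.
  have h3 : ∀ Z, (incl ∘ₗ D ∘ₗ skewPart) Z = (1 / 2 : ℂ) •
      (((X.1 * Y.1) * Z * 1 - X.1 * Z * Y.1 - Y.1 * Z * X.1 + 1 * Z * (Y.1 * X.1)) -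
        ((X.1 * Y.1) * Zᵀ * 1 - X.1 * Zᵀ * Y.1 - Y.1 * Zᵀ * X.1 + 1 * Zᵀ * (Y.1 * X.1))) := by
    intro Z
    change X.1 * (Y.1 * (skewPart Z).1 - (skewPart Z).1 * Y.1) -
      (Y.1 * (skewPart Z).1 - (skewPart Z).1 * Y.1) * X.1 = _
    rw [skewPart_coe]
    simp only [Matrix.mul_smul, Matrix.smul_mul, ← smul_sub]
    congr 1
    noncomm_ring
  rw [h2, trace_end_matrix]
  simp only [h3, Matrix.smul_apply, Matrix.sub_apply, Matrix.add_apply, ← Finset.smul_sum,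
    Finset.sum_sub_distrib, Finset.sum_add_distrib, Matrix.transpose_single,
    sum_mul_single_mul, sum_mul_single_transpose_mul]
  simp only [hX, hY, Matrix.transpose_mul, Matrix.transpose_one, Matrix.trace_one, Matrix.mul_neg,
    Matrix.trace_neg, Matrix.mul_one, Matrix.one_mul, Matrix.neg_mul, neg_neg]
  have hXt : X.1.trace = 0 := by
    have := congrArg Matrix.trace hX
    rw [Matrix.trace_transpose, Matrix.trace_neg] at this
    linear_combination this / 2
  rw [Matrix.trace_mul_comm Y.1 X.1, hXt, smul_eq_mul]
  ring

/-- If `∑ x_k ⊗ y_k` is inverse to the Killing form, then it is the split Casimir element, in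
whatever basis the latter is written. The families need not be bases. -/
theorem splitCasimir_eq_sum {𝔤 : Type*} [LieRing 𝔤] [LieAlgebra ℂ 𝔤] {ι κ : Type*} [Fintype ι]
    [DecidableEq ι] [Fintype κ] (b : Module.Basis ι ℂ 𝔤) {V W : Type*} [AddCommGroup V]
    [Module ℂ V] [AddCommGroup W] [Module ℂ W] (φ : 𝔤 →ₗ[ℂ] Module.End ℂ V)
    (ψ : 𝔤 →ₗ[ℂ] Module.End ℂ W) (x y : κ → 𝔤)
    (h : ∀ Z, ∑ k, killingForm ℂ 𝔤 Z (x k) • y k = Z) :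
    splitCasimir b φ ψ = ∑ k, TensorProduct.map (φ (x k)) (ψ (y k)) := by
  have hinv : (killingMetric b)⁻¹ = Matrix.of fun A B => ∑ k, b.repr (x k) A * b.repr (y k) B := by
    apply Matrix.inv_eq_right_inv
    ext C B
    have h1 := congrArg (fun Z => b.repr Z B) (h (b C))
    simp only [map_sum, map_smul, Finsupp.coe_finsetSum, Finset.sum_apply, Finsupp.smul_apply,
      smul_eq_mul, b.repr_self] at h1
    rw [Matrix.mul_apply, Matrix.one_apply]
    simp only [killingMetric, Matrix.of_apply, Finset.mul_sum]
    rw [Finset.sum_comm, ← Finsupp.single_apply, ← h1]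
    refine Finset.sum_congr rfl fun k _ => ?_
    conv_rhs => rw [← b.sum_repr (x k)]
    simp only [map_sum, map_smul, smul_eq_mul, Finset.sum_mul]
    exact Finset.sum_congr rfl fun A _ => by ring
  rw [splitCasimir, hinv]
  have hk : ∀ k, TensorProduct.map (φ (x k)) (ψ (y k)) = ∑ A, ∑ B,
      (b.repr (x k) A * b.repr (y k) B) • TensorProduct.map (φ (b A)) (ψ (b B)) := by
    intro k
    have hM : ∀ f g, TensorProduct.map f g =
      TensorProduct.mapBilinear (RingHom.id ℂ) V W V W f g := fun _ _ => rfl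
    conv_lhs => rw [← b.sum_repr (x k), ← b.sum_repr (y k)]
    simp only [map_sum, map_smul, hM,
      LinearMap.sum_apply, LinearMap.smul_apply, Finset.smul_sum, smul_smul]
    rw [Finset.sum_comm]
    simp only [mul_comm]
  simp only [hk, Matrix.of_apply, Finset.sum_smul]
  conv_rhs => rw [Finset.sum_comm]
  exact Finset.sum_congr rfl fun A _ => Finset.sum_comm

/-- The generators `M_{ij} = e_{ij} - e_{ji}` of `so_n`. -/
def skewUnit (i j : n) : LieAlgebra.Orthogonal.so n ℂ :=
  ⟨Matrix.single i j 1 - Matrix.single j i 1, by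
    rw [LieAlgebra.Orthogonal.mem_so]; simp [Matrix.transpose_single]⟩

theorem killingForm_skewUnit (Z : LieAlgebra.Orthogonal.so n ℂ) (i j : n) :
    killingForm ℂ (LieAlgebra.Orthogonal.so n ℂ) Z (skewUnit i j) =
      -2 * ((Fintype.card n : ℂ) - 2) * Z.1 i j := by
  have hZ : Z.1 j i = -Z.1 i j :=
    congrFun (congrFun ((LieAlgebra.Orthogonal.mem_so _ _ Z.1).1 Z.2) i) j
  rw [killingForm_so]
  simp only [skewUnit, Matrix.mul_sub, Matrix.trace_sub, Matrix.trace_mul_single, hZ]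
  simp
  ring

theorem sum_smul_skewUnit (Z : LieAlgebra.Orthogonal.so n ℂ) :
    ∑ i, ∑ j, Z.1 i j • skewUnit i j = (2 : ℂ) • Z := by
  have hZ := (LieAlgebra.Orthogonal.mem_so _ _ Z.1).1 Z.2
  apply Subtype.ext
  have h : ((∑ i, ∑ j, Z.1 i j • skewUnit i j : LieAlgebra.Orthogonal.so n ℂ) : Matrix n n ℂ) =
      ∑ i, ∑ j, Z.1 i j • (Matrix.single i j 1 - Matrix.single j i 1) := by
    simp [skewUnit]
  rw [h]
  ext a c
  have h2 : Z.1 c a = -Z.1 a c := congrFun (congrFun hZ a) c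
  simp [Matrix.sum_apply, Matrix.single_apply, ite_and, mul_sub, Finset.sum_sub_distrib, h2]
  ring

end Casimir

/-! ### The commuting involutions `ρ(Γ_i) ⊗ ρ(Γ_i)` -/

section Spinor

variable (r : ℕ) (V : Type*) [AddCommGroup V] [Module ℂ V] [Module (Cl r) V]
  [IsScalarTower ℂ (Cl r) V]

/-- The operators `ρ(Γ_i) ⊗ ρ(Γ_i)`. -/
def gammaSq (i : Fin (2 * r)) : Module.End ℂ (V ⊗[ℂ] V) :=
  TensorProduct.map (rho r V (gamma r i)) (rho r V (gamma r i))

/-- The chirality `ρ(Γ_{2r+1}) ⊗ 1` of the first factor. -/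
def chirL : Module.End ℂ (V ⊗[ℂ] V) := TensorProduct.map (rho r V (gammaTop r)) 1

/-- The chirality `1 ⊗ ρ(Γ_{2r+1})` of the second factor. -/
def chirR : Module.End ℂ (V ⊗[ℂ] V) := TensorProduct.map 1 (rho r V (gammaTop r))

theorem tensorMap_neg_left {V W : Type*} [AddCommGroup V] [Module ℂ V] [AddCommGroup W]
    [Module ℂ W] (f : Module.End ℂ V)
    (g : Module.End ℂ W) : TensorProduct.map (-f) g = -TensorProduct.map f g := by
  ext; simp [TensorProduct.neg_tmul]

theorem tensorMap_neg_right {V W : Type*} [AddCommGroup V] [Module ℂ V] [AddCommGroup W]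
    [Module ℂ W] (f : Module.End ℂ V)
    (g : Module.End ℂ W) : TensorProduct.map f (-g) = -TensorProduct.map f g := by
  ext; simp [TensorProduct.tmul_neg]

theorem gammaSq_comm (i j : Fin (2 * r)) :
    gammaSq r V i * gammaSq r V j = gammaSq r V j * gammaSq r V i := by
  by_cases h : i = j
  · rw [h]
  · rw [gammaSq, gammaSq, ← TensorProduct.map_mul, ← TensorProduct.map_mul, ← map_mul, ← map_mul,
      gamma_mul_gamma r i j h, map_neg, tensorMap_neg_left, tensorMap_neg_right, neg_neg]

theorem gammaSq_mul_self (i : Fin (2 * r)) : gammaSq r V i * gammaSq r V i = 1 := by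
  rw [gammaSq, ← TensorProduct.map_mul, ← map_mul, gamma_mul_self, map_one, TensorProduct.map_one]

theorem chirL_mul_self : chirL r V * chirL r V = 1 := by
  rw [chirL, ← TensorProduct.map_mul, ← map_mul, gammaTop_mul_self, map_one, one_mul,
    TensorProduct.map_one]

theorem chirR_mul_self : chirR r V * chirR r V = 1 := by
  rw [chirR, ← TensorProduct.map_mul, ← map_mul, gammaTop_mul_self, map_one, one_mul,
    TensorProduct.map_one]

theorem chirL_mul_chirR : chirL r V * chirR r V =
    TensorProduct.map (rho r V (gammaTop r)) (rho r V (gammaTop r)) := by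
  rw [chirL, chirR, ← TensorProduct.map_mul, mul_one, one_mul]

theorem chirR_mul_chirL : chirR r V * chirL r V = chirL r V * chirR r V := by
  rw [chirL_mul_chirR, chirL, chirR, ← TensorProduct.map_mul, mul_one, one_mul]

theorem gammaSq_mul_chirL (i : Fin (2 * r)) :
    gammaSq r V i * chirL r V = -(chirL r V * gammaSq r V i) := by
  rw [chirL, gammaSq, ← TensorProduct.map_mul, ← TensorProduct.map_mul, ← map_mul, ← map_mul,
    gamma_mul_gammaTop, map_neg, tensorMap_neg_left, mul_one, one_mul]

theorem gammaSq_mul_chirR (i : Fin (2 * r)) :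
    gammaSq r V i * chirR r V = -(chirR r V * gammaSq r V i) := by
  rw [chirR, gammaSq, ← TensorProduct.map_mul, ← TensorProduct.map_mul, ← map_mul, ← map_mul,
    gamma_mul_gammaTop, map_neg, tensorMap_neg_right, mul_one, one_mul]

theorem map_rho_prod {k : ℕ} (i : Fin k → Fin (2 * r)) :
    TensorProduct.map (rho r V (List.ofFn fun l => gamma r (i l)).prod)
      (rho r V (List.ofFn fun l => gamma r (i l)).prod) =
      (List.ofFn fun l => gammaSq r V (i l)).prod := by
  induction k with
  | zero => simp [TensorProduct.map_one]
  | succ k ih =>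
    rw [List.ofFn_succ, List.ofFn_succ, List.prod_cons, List.prod_cons, map_mul,
      TensorProduct.map_mul, ih fun l => i l.succ, gammaSq]

/-- Only tuples of distinct indices contribute, and for them antisymmetrisation does nothing. -/
theorem invariantI_eq (k : ℕ) : invariantI r V k = tupleSum (gammaSq r V) k := by
  classical
  rw [invariantI, tupleSum, Finset.sum_filter]
  refine Finset.sum_congr rfl fun i _ => ?_
  split_ifs with hi
  · rw [gammaAntisymm_of_injective r hi, map_rho_prod]
  · rw [gammaAntisymm_of_not_injective r hi, map_zero, TensorProduct.map_zero_left]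

/-- The sign is `((-i)^r)⁻²`, from the normalisation of `Γ_{2r+1}`. -/
theorem prod_gammaSq : (List.ofFn (gammaSq r V)).prod =
    (-1 : ℂ) ^ r • (chirL r V * chirR r V) := by
  rw [chirL_mul_chirR, gammaTop, map_smul, TensorProduct.map_smul_left,
    TensorProduct.map_smul_right, smul_smul, smul_smul, ← mul_pow, ← mul_pow,
    ← map_rho_prod r V fun l => l]
  simp

/-! ### The split Casimir operator and the polynomials `I_{2k}(x)` -/

theorem soToCl_skewUnit (i j : Fin (2 * r)) : soToCl r (skewUnit i j) =
    (1 / 4 : ℂ) • (gamma r i * gamma r j - gamma r j * gamma r i) := by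
  change (1 / 2 : ℂ) • ∑ k, ∑ l, (skewUnit i j).1 k l •
    ((1 / 4 : ℂ) • (gamma r k * gamma r l - gamma r l * gamma r k)) = _
  simp only [skewUnit, Matrix.sub_apply, Matrix.single_apply, sub_smul, Finset.sum_sub_distrib,
    ite_and, ite_smul, one_smul, zero_smul]
  simp only [Finset.sum_ite_eq, Finset.sum_ite_irrel, Finset.sum_const_zero, Finset.mem_univ,
    if_true]
  module

theorem map_spinorRep_skewUnit (i j : Fin (2 * r)) :
    TensorProduct.map (spinorRep r V (skewUnit i j)) (spinorRep r V (skewUnit i j)) =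
      (1 / 4 : ℂ) • (gammaSq r V i * gammaSq r V j - if i = j then 1 else 0) := by
  have h : spinorRep r V (skewUnit i j) = rho r V (soToCl r (skewUnit i j)) := rfl
  rw [h, soToCl_skewUnit]
  split_ifs with hij
  · subst hij
    rw [gammaSq_mul_self]
    simp
  · have h2 : (1 / 4 : ℂ) • (gamma r i * gamma r j - gamma r j * gamma r i) =
        (1 / 2 : ℂ) • (gamma r i * gamma r j) := by
      rw [gamma_mul_gamma r j i (Ne.symm hij)]
      module
    rw [h2, map_smul, map_mul, TensorProduct.map_smul_left, TensorProduct.map_smul_right,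
      TensorProduct.map_mul, smul_smul, gammaSq, gammaSq, sub_zero]
    norm_num

/-- The split Casimir element is `-1 / (8 (r - 1)) ∑ M_{ij} ⊗ M_{ij}`, summed over all pairs `i, j`:
the Killing form pairs `Z` with `M_{ij}` to `-4 (r - 1) Z_{ij}`, and `∑ Z_{ij} M_{ij} = 2 Z`. -/
theorem smul_casimirRho (hr : 2 ≤ r) {ι : Type*} [Fintype ι] [DecidableEq ι]
    (b : Module.Basis ι ℂ (so r)) :
    (-32 * ((r : ℂ) - 1)) • casimirRho r V b = tupleSum (gammaSq r V) 2 := by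
  have hr1 : (r : ℂ) - 1 ≠ 0 := by
    rw [sub_ne_zero]; exact_mod_cast (show r ≠ 1 by omega)
  have hdual : ∀ Z : so r, ∑ p : Fin (2 * r) × Fin (2 * r),
      killingForm ℂ (so r) Z (skewUnit p.1 p.2) •
        ((-1 / (8 * ((r : ℂ) - 1))) • skewUnit p.1 p.2 : so r) = Z := by
    intro Z
    have h : ∀ i j, killingForm ℂ (so r) Z (skewUnit i j) •
        ((-1 / (8 * ((r : ℂ) - 1))) • skewUnit i j : so r) =
        (1 / 2 : ℂ) • (Z.1 i j • skewUnit i j) := by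
      intro i j
      rw [killingForm_skewUnit, smul_smul, smul_smul, Fintype.card_fin]
      congr 1
      push_cast
      field_simp
      ring
    rw [Fintype.sum_prod_type]
    simp only [h, ← Finset.smul_sum]
    rw [sum_smul_skewUnit, smul_smul]
    norm_num
  rw [casimirRho, splitCasimir_eq_sum b _ _ _ _ hdual, Fintype.sum_prod_type]
  simp only [map_smul, TensorProduct.map_smul_right, map_spinorRep_skewUnit, ← Finset.smul_sum,
    Finset.sum_sub_distrib]
  rw [tupleSum_two (gammaSq_comm r V) (gammaSq_mul_self r V), Finset.sum_mul_sum, smul_smul,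
    smul_smul]
  have hc : -32 * ((r : ℂ) - 1) * (-1 / (8 * ((r : ℂ) - 1))) * (1 / 4) = 1 := by
    field_simp; norm_num
  rw [hc, one_smul]
  simp

theorem aeval_casimirRho (hr : 2 ≤ r) {ι : Type*} [Fintype ι] [DecidableEq ι]
    (b : Module.Basis ι ℂ (so r)) (k : ℕ) :
    Polynomial.aeval (casimirRho r V b) (polyI r k) = invariantI r V (2 * k) := by
  rw [invariantI_eq]
  have hX : Polynomial.aeval (casimirRho r V b)
      (Polynomial.C (-32 * ((r : ℂ) - 1)) * Polynomial.X) = tupleSum (gammaSq r V) 2 := by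
    rw [← smul_casimirRho r V hr b, map_mul, Polynomial.aeval_C, Polynomial.aeval_X,
      Algebra.smul_def]
  induction k using Nat.twoStepInduction with
  | zero => simp [polyI, tupleSum_zero]
  | one => exact hX
  | more k ih1 ih2 =>
    have h := tupleSum_mul_tupleSum_two (Fintype.card_fin (2 * r)) (gammaSq_comm r V)
      (gammaSq_mul_self r V) k
    rw [polyI]
    simp only [map_sub, map_mul (Polynomial.aeval _) (polyI r (k + 1)), hX]
    simp only [map_mul (Polynomial.aeval _) (Polynomial.C _), ih1, ih2, Polynomial.aeval_C]
    rw [show 2 * (k + 1) = 2 * k + 2 by ring, show 2 * (k + 2) = 2 * k + 4 by ring, h]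
    simp only [map_mul, map_add, map_sub, map_one, map_natCast, map_ofNat]
    abel

theorem degree_polyI (hr : 2 ≤ r) (k : ℕ) : (polyI r k).degree = k := by
  have hr1 : (r : ℂ) - 1 ≠ 0 := by
    rw [sub_ne_zero]; exact_mod_cast (show r ≠ 1 by omega)
  have hX : (Polynomial.C (-32 * ((r : ℂ) - 1)) * Polynomial.X).degree = 1 :=
    Polynomial.degree_C_mul_X (mul_ne_zero (by norm_num) hr1)
  induction k using Nat.twoStepInduction with
  | zero => simp [polyI]
  | one => exact hX
  | more k ih1 ih2 =>
    have hlt : ∀ (c : ℂ) (m : ℕ), m < k + 2 → (polyI r m).degree = m →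
        (Polynomial.C c * polyI r m).degree < ((k + 2 : ℕ) : WithBot ℕ) := by
      intro c m hm hd
      refine lt_of_le_of_lt ((Polynomial.smul_eq_C_mul c ▸ Polynomial.degree_smul_le c _)) ?_
      rw [hd]; exact_mod_cast hm
    have h1 : (polyI r (k + 1) * (Polynomial.C (-32 * ((r : ℂ) - 1)) * Polynomial.X)).degree =
        ((k + 2 : ℕ) : WithBot ℕ) := by
      rw [Polynomial.degree_mul, ih2, hX]; push_cast; rfl
    have h2 : (polyI r (k + 1) * (Polynomial.C (-32 * ((r : ℂ) - 1)) * Polynomial.X) -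
        Polynomial.C (8 * ((k : ℂ) + 1) * ((r : ℂ) - ((k : ℂ) + 1))) * polyI r (k + 1)).degree =
        ((k + 2 : ℕ) : WithBot ℕ) := by
      rw [Polynomial.degree_sub_eq_left_of_degree_lt, h1]
      rw [h1]; exact hlt _ _ (by omega) ih2
    rw [polyI]
    rw [Polynomial.degree_sub_eq_left_of_degree_lt, h2]
    rw [h2]; exact hlt _ _ (by omega) ih1

theorem degree_polyI_sub (hr : 2 ≤ r) {m m' : ℕ} (h : m' < m) (c : ℂ) :
    (polyI r m - Polynomial.C c * polyI r m').degree = m := by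
  rw [Polynomial.degree_sub_eq_left_of_degree_lt, degree_polyI r hr]
  refine lt_of_le_of_lt (Polynomial.smul_eq_C_mul c ▸ Polynomial.degree_smul_le c _) ?_
  rw [degree_polyI r hr, degree_polyI r hr]
  exact_mod_cast h

end Spinor

/-! ### Joint eigenvectors and the chiral subspaces -/

section Chiral

variable (r : ℕ) (V : Type*) [AddCommGroup V] [Module ℂ V] [Module (Cl r) V]
  [IsScalarTower ℂ (Cl r) V]

/-- The operators `ρ(Γ_i) ⊗ 1`. -/
def gammaL (i : Fin (2 * r)) : Module.End ℂ (V ⊗[ℂ] V) :=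
  TensorProduct.map (rho r V (gamma r i)) 1

theorem gammaL_mul_self (i : Fin (2 * r)) : gammaL r V i * gammaL r V i = 1 := by
  rw [gammaL, ← TensorProduct.map_mul, ← map_mul, gamma_mul_self, map_one, one_mul,
    TensorProduct.map_one]

theorem gammaSq_mul_gammaL_self (i : Fin (2 * r)) :
    gammaSq r V i * gammaL r V i = gammaL r V i * gammaSq r V i := by
  rw [gammaL, gammaSq, ← TensorProduct.map_mul, ← TensorProduct.map_mul, mul_one, one_mul]

theorem gammaSq_mul_gammaL {i j : Fin (2 * r)} (h : j ≠ i) :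
    gammaSq r V j * gammaL r V i = -(gammaL r V i * gammaSq r V j) := by
  rw [gammaL, gammaSq, ← TensorProduct.map_mul, ← TensorProduct.map_mul, ← map_mul, ← map_mul,
    gamma_mul_gamma r j i h, map_neg, tensorMap_neg_left, mul_one, one_mul]

/-- Every sign pattern occurs as a joint eigenvalue of the `ρ(Γ_i) ⊗ ρ(Γ_i)`: a wrong sign at the
index `i` alone is corrected by applying `ρ(Γ_i Γ_{2r+1}) ⊗ 1`. -/
theorem exists_joint_eigenvector [Nontrivial V] (s : Fin (2 * r) → ℂ) (hs : ∀ i, s i * s i = 1) :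
    ∃ v : V ⊗[ℂ] V, v ≠ 0 ∧ ∀ i, gammaSq r V i v = s i • v := by
  suffices h : ∀ F : Finset (Fin (2 * r)),
      ∃ v : V ⊗[ℂ] V, v ≠ 0 ∧ ∀ i ∈ F, gammaSq r V i v = s i • v by
    obtain ⟨v, hv, h⟩ := h Finset.univ
    exact ⟨v, hv, fun i => h i (Finset.mem_univ i)⟩
  intro F
  induction F using Finset.induction_on with
  | empty =>
    obtain ⟨v, hv⟩ := exists_ne (0 : V ⊗[ℂ] V)
    exact ⟨v, hv, by simp⟩
  | insert i F hi ih =>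
    -- `v + s i • gammaSq i v` is twice the projection of `v` to the eigenvalue `s i`. If it
    -- vanishes, then `v` has the eigenvalue `-s i`.
    obtain ⟨v, hv, h⟩ := ih
    have hsq : ∀ w, gammaSq r V i (gammaSq r V i w) = w := fun w =>
      LinearMap.congr_fun (gammaSq_mul_self r V i) w
    by_cases h0 : v + s i • gammaSq r V i v = 0
    · have hiv : gammaSq r V i v = -(s i • v) := by
        have h1 := congrArg (fun w => s i • w) h0
        simp only [smul_add, smul_smul, hs, one_smul, smul_zero] at h1
        exact eq_neg_of_add_eq_zero_right h1
      have hL : ∀ w, gammaL r V i (gammaL r V i w) = w := fun w =>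
        LinearMap.congr_fun (gammaL_mul_self r V i) w
      have hC : ∀ w, chirL r V (chirL r V w) = w := fun w =>
        LinearMap.congr_fun (chirL_mul_self r V) w
      have hAC : ∀ j w, gammaSq r V j (chirL r V w) = -chirL r V (gammaSq r V j w) := fun j w =>
        LinearMap.congr_fun (gammaSq_mul_chirL r V j) w
      refine ⟨gammaL r V i (chirL r V v), fun h1 => hv ?_, fun j hj => ?_⟩
      · rw [← hC v, ← hL (chirL r V v), h1, map_zero, map_zero]
      · rcases eq_or_ne j i with rfl | hji
        · have hAL : ∀ w, gammaSq r V j (gammaL r V j w) = gammaL r V j (gammaSq r V j w) :=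
            fun w => LinearMap.congr_fun (gammaSq_mul_gammaL_self r V j) w
          rw [hAL, hAC, hiv, map_neg, map_neg, map_neg, neg_neg, map_smul, map_smul]
        · have hAL : ∀ w, gammaSq r V j (gammaL r V i w) = -gammaL r V i (gammaSq r V j w) :=
            fun w => LinearMap.congr_fun (gammaSq_mul_gammaL r V hji) w
          rw [hAL, hAC, map_neg, neg_neg, h j (Finset.mem_of_mem_insert_of_ne hj hji), map_smul,
            map_smul]
    · refine ⟨v + s i • gammaSq r V i v, h0, fun j hj => ?_⟩
      rcases eq_or_ne j i with rfl | hji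
      · rw [map_add, map_smul, hsq, smul_add, smul_smul, hs, one_smul, add_comm]
      · have hc : gammaSq r V j (gammaSq r V i v) = gammaSq r V i (gammaSq r V j v) :=
          LinearMap.congr_fun (gammaSq_comm r V j i) v
        rw [map_add, map_smul, hc, h j (Finset.mem_of_mem_insert_of_ne hj hji), map_smul, smul_add,
          smul_comm (s i)]

theorem unit_mul_self_complex (ε : ℤˣ) : ((ε : ℤ) : ℂ) * ((ε : ℤ) : ℂ) = 1 := by
  rcases Int.units_eq_one_or ε with h | h <;> simp [h]

theorem chiralProj₂_apply (ε ε' : ℤˣ) (w : V ⊗[ℂ] V) : chiralProj₂ r V ε ε' w =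
    (1 / 4 : ℂ) • (w + ((ε : ℤ) : ℂ) • chirL r V w + ((ε' : ℤ) : ℂ) • chirR r V w +
      (((ε : ℤ) : ℂ) * ((ε' : ℤ) : ℂ)) • chirL r V (chirR r V w)) := by
  have h : chirL r V (chirR r V w) =
      TensorProduct.map (rho r V (gammaTop r)) (rho r V (gammaTop r)) w :=
    LinearMap.congr_fun (chirL_mul_chirR r V) w
  rw [h, chiralProj₂, chiralProj, chiralProj, chirL, chirR]
  simp only [TensorProduct.map_smul_left, TensorProduct.map_smul_right,
    TensorProduct.map_add_left, TensorProduct.map_add_right, LinearMap.add_apply,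
    LinearMap.smul_apply, TensorProduct.map_one, Module.End.one_apply]
  module

theorem chiralProj₂_of_chirality {ε ε' : ℤˣ} {w : V ⊗[ℂ] V} (h : chirL r V w = ((ε : ℤ) : ℂ) • w)
    (h' : chirR r V w = ((ε' : ℤ) : ℂ) • w) : chiralProj₂ r V ε ε' w = w := by
  have h1 := unit_mul_self_complex ε
  have h2 := unit_mul_self_complex ε'
  rw [chiralProj₂_apply, h', map_smul, h]
  simp only [smul_smul, h1, h2, one_smul]
  rw [show ((ε : ℤ) : ℂ) * ((ε' : ℤ) : ℂ) * (((ε' : ℤ) : ℂ) * ((ε : ℤ) : ℂ)) = 1 by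
    linear_combination ((ε' : ℤ) : ℂ) * ((ε' : ℤ) : ℂ) * h1 + h2]
  module

/-- The image of `P_{εε'}` is the joint eigenspace of the two chirality operators. -/
theorem mem_chiralSpace {ε ε' : ℤˣ} {w : V ⊗[ℂ] V} : w ∈ ChiralSpace r V ε ε' ↔
    chirL r V w = ((ε : ℤ) : ℂ) • w ∧ chirR r V w = ((ε' : ℤ) : ℂ) • w := by
  refine ⟨?_, fun h => ⟨w, chiralProj₂_of_chirality r V h.1 h.2⟩⟩
  rintro ⟨u, rfl⟩
  have h1 := unit_mul_self_complex ε
  have h2 := unit_mul_self_complex ε'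
  have hL : ∀ w, chirL r V (chirL r V w) = w := fun w =>
    LinearMap.congr_fun (chirL_mul_self r V) w
  have hR : ∀ w, chirR r V (chirR r V w) = w := fun w =>
    LinearMap.congr_fun (chirR_mul_self r V) w
  have hLR : ∀ w, chirR r V (chirL r V w) = chirL r V (chirR r V w) := fun w =>
    LinearMap.congr_fun (chirR_mul_chirL r V) w
  rw [chiralProj₂_apply]
  simp only [map_smul, map_add, hL, hR, hLR, smul_add, smul_smul]
  constructor
  · linear_combination (norm := module) (-(1 / 4 : ℂ) * h1) • chirL r V u +
      (-(1 / 4 : ℂ) * ((ε' : ℤ) : ℂ) * h1) • chirL r V (chirR r V u)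
  · linear_combination (norm := module) (-(1 / 4 : ℂ) * h2) • chirR r V u +
      (-(1 / 4 : ℂ) * ((ε : ℤ) : ℂ) * h2) • chirL r V (chirR r V u)

theorem sum_gammaSq_apply {v : V ⊗[ℂ] V} {s : Fin (2 * r) → ℂ}
    (h : ∀ i, gammaSq r V i v = s i • v) : (∑ i, gammaSq r V i) v = (∑ i, s i) • v := by
  rw [LinearMap.sum_apply, Finset.sum_smul]
  exact Finset.sum_congr rfl fun i _ => h i

theorem prod_ofFn_apply {M : Type*} [AddCommGroup M] [Module ℂ M] {n : ℕ}
    {a : Fin n → Module.End ℂ M} {v : M} {s : Fin n → ℂ} (h : ∀ i, a i v = s i • v) :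
    (List.ofFn a).prod v = (∏ i, s i) • v := by
  induction n with
  | zero => simp
  | succ n ih =>
    rw [List.ofFn_succ, List.prod_cons, Module.End.mul_apply, ih fun i => h i.succ, map_smul, h,
      smul_smul, Fin.prod_univ_succ, mul_comm]

theorem sum_gammaSq_mul_chirL :
    (∑ i, gammaSq r V i) * chirL r V = -(chirL r V * ∑ i, gammaSq r V i) := by
  rw [Finset.sum_mul, Finset.mul_sum, ← Finset.sum_neg_distrib]
  exact Finset.sum_congr rfl fun i _ => gammaSq_mul_chirL r V i

theorem sum_gammaSq_mul_chirR :
    (∑ i, gammaSq r V i) * chirR r V = -(chirR r V * ∑ i, gammaSq r V i) := by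
  rw [Finset.sum_mul, Finset.mul_sum, ← Finset.sum_neg_distrib]
  exact Finset.sum_congr rfl fun i _ => gammaSq_mul_chirR r V i

variable {r} (hr : 2 ≤ r) {ι : Type*} [Fintype ι] [DecidableEq ι] (b : Module.Basis ι ℂ (so r))
include hr

theorem casimirRho_eq : casimirRho r V b = (-32 * ((r : ℂ) - 1))⁻¹ •
    ((∑ i, gammaSq r V i) * (∑ i, gammaSq r V i) - (2 * r : ℂ) • 1) := by
  have hr1 : (r : ℂ) - 1 ≠ 0 := by
    rw [sub_ne_zero]; exact_mod_cast (show r ≠ 1 by omega)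
  rw [eq_inv_smul_iff₀ (mul_ne_zero (by norm_num) hr1), smul_casimirRho r V hr b,
    tupleSum_two (gammaSq_comm r V) (gammaSq_mul_self r V), Fintype.card_fin]
  rw [← Algebra.algebraMap_eq_smul_one]
  simp [map_ofNat]

theorem casimirRho_mul_chirL : casimirRho r V b * chirL r V = chirL r V * casimirRho r V b := by
  have h : (∑ i, gammaSq r V i) * (∑ i, gammaSq r V i) * chirL r V =
      chirL r V * ((∑ i, gammaSq r V i) * (∑ i, gammaSq r V i)) := by
    have hJ : ∀ u, (∑ i, gammaSq r V i) (chirL r V u) = -chirL r V ((∑ i, gammaSq r V i) u) :=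
      fun u => LinearMap.congr_fun (sum_gammaSq_mul_chirL r V) u
    refine LinearMap.ext fun u => ?_
    simp only [Module.End.mul_apply, hJ, map_neg, neg_neg]
  rw [casimirRho_eq V hr b, smul_mul_assoc, mul_smul_comm, sub_mul, h,
    mul_sub (chirL r V), smul_mul_assoc, mul_smul_comm, one_mul, mul_one]

theorem casimirRho_mul_chirR : casimirRho r V b * chirR r V = chirR r V * casimirRho r V b := by
  have h : (∑ i, gammaSq r V i) * (∑ i, gammaSq r V i) * chirR r V =
      chirR r V * ((∑ i, gammaSq r V i) * (∑ i, gammaSq r V i)) := by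
    have hJ : ∀ u, (∑ i, gammaSq r V i) (chirR r V u) = -chirR r V ((∑ i, gammaSq r V i) u) :=
      fun u => LinearMap.congr_fun (sum_gammaSq_mul_chirR r V) u
    refine LinearMap.ext fun u => ?_
    simp only [Module.End.mul_apply, hJ, map_neg, neg_neg]
  rw [casimirRho_eq V hr b, smul_mul_assoc, mul_smul_comm, sub_mul, h,
    mul_sub (chirR r V), smul_mul_assoc, mul_smul_comm, one_mul, mul_one]

/-- `Ĉ_{εε'}` is the restriction of `Ĉ_ρ`, since `Ĉ_ρ` preserves the chiral subspaces. -/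
theorem coe_casimirChiral (ε ε' : ℤˣ) (w : ChiralSpace r V ε ε') :
    (casimirChiral r V b ε ε' w : V ⊗[ℂ] V) = casimirRho r V b w := by
  obtain ⟨h1, h2⟩ := (mem_chiralSpace r V).1 w.2
  have hL : casimirRho r V b (chirL r V w) = chirL r V (casimirRho r V b w) :=
    LinearMap.congr_fun (casimirRho_mul_chirL V hr b) w.1
  have hR : casimirRho r V b (chirR r V w) = chirR r V (casimirRho r V b w) :=
    LinearMap.congr_fun (casimirRho_mul_chirR V hr b) w.1
  change chiralProj₂ r V ε ε' (casimirRho r V b w) = _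
  refine chiralProj₂_of_chirality r V ?_ ?_
  · rw [← hL, h1, map_smul]
  · rw [← hR, h2, map_smul]

theorem coe_aeval_casimirChiral (ε ε' : ℤˣ) (p : Polynomial ℂ) (w : ChiralSpace r V ε ε') :
    (Polynomial.aeval (casimirChiral r V b ε ε') p w : V ⊗[ℂ] V) =
      Polynomial.aeval (casimirRho r V b) p w := by
  induction p using Polynomial.induction_on generalizing w with
  | C a => simp [Module.algebraMap_end_apply]
  | add p q hp hq => simp [hp, hq]
  | monomial n a ih =>
    rw [pow_succ, ← mul_assoc, map_mul _ _ Polynomial.X, map_mul _ _ Polynomial.X,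
      Polynomial.aeval_X, Polynomial.aeval_X, Module.End.mul_apply, Module.End.mul_apply, ih,
      coe_casimirChiral V hr b]

/-- For each `j ≤ r` of the parity prescribed by the chiralities, a joint eigenvector with `r - j`
minus signs yields an eigenvector of the split Casimir operator on the chiral subspace. -/
theorem hasEigenvalue_casimirChiral [Nontrivial V] (ε ε' : ℤˣ) {j : ℕ} (hj : j ≤ r)
    (hε : ((ε : ℤ) : ℂ) * ((ε' : ℤ) : ℂ) = (-1) ^ j) :
    (casimirChiral r V b ε ε').HasEigenvalue
      ((-32 * ((r : ℂ) - 1))⁻¹ * ((2 * j) * (2 * j) - 2 * r)) := by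
  set s : Fin (2 * r) → ℂ := fun i => if i.val < r - j then -1 else 1 with hs
  have hs1 : ∀ i, s i * s i = 1 := by
    intro i; simp only [hs]; split_ifs <;> norm_num
  have hcard : (Finset.univ.filter fun i : Fin (2 * r) => i.val < r - j).card = r - j := by
    rw [Fin.card_filter_val_lt]; omega
  have hsum : ∑ i, s i = 2 * j := by
    have h1 : ∀ i, s i = 1 - 2 * (if i.val < r - j then 1 else 0) := by
      intro i; simp only [hs]; split_ifs <;> norm_num
    simp only [h1, Finset.sum_sub_distrib, ← Finset.mul_sum, Finset.sum_boole, hcard]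
    simp [Nat.cast_sub hj]
    ring
  have hprod : ∏ i, s i = (-1) ^ (r - j) := by
    simp only [hs, Finset.prod_ite, Finset.prod_const, one_pow, mul_one, hcard]
  obtain ⟨v, hv, h⟩ := exists_joint_eigenvector r V s hs1
  have hLL : ∀ w, chirL r V (chirL r V w) = w := fun w =>
    LinearMap.congr_fun (chirL_mul_self r V) w
  have hLR : ∀ w, chirR r V (chirL r V w) = chirL r V (chirR r V w) := fun w =>
    LinearMap.congr_fun (chirR_mul_chirL r V) w
  have hε1 := unit_mul_self_complex ε
  have hLRv : chirL r V (chirR r V v) = (((ε : ℤ) : ℂ) * ((ε' : ℤ) : ℂ)) • v := by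
    have h1 := prod_ofFn_apply h
    rw [prod_gammaSq, hprod, LinearMap.smul_apply, Module.End.mul_apply] at h1
    have h2 := congrArg (fun w => (-1 : ℂ) ^ r • w) h1
    simp only [smul_smul, ← pow_add] at h2
    rw [Even.neg_one_pow ⟨r, rfl⟩, one_smul] at h2
    rw [h2, hε, show r + (r - j) = 2 * (r - j) + j by omega, pow_add, pow_mul]
    simp
  have hRv : chirR r V v = (((ε : ℤ) : ℂ) * ((ε' : ℤ) : ℂ)) • chirL r V v := by
    rw [← hLL (chirR r V v), hLRv, map_smul]
  -- The chirality operators permute the joint eigenvectors; `w` is twice the projection of `v`.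
  set w : V ⊗[ℂ] V := v + ((ε : ℤ) : ℂ) • chirL r V v with hw
  have hwmem : w ∈ ChiralSpace r V ε ε' := by
    rw [mem_chiralSpace]
    constructor
    · rw [hw, map_add, map_smul, hLL, smul_add, smul_smul, hε1, one_smul, add_comm]
    · rw [hw, map_add, map_smul, hLR, hLRv, hRv, smul_add, smul_smul, smul_smul, ← mul_assoc, hε1,
        one_mul, add_comm, mul_comm ((ε' : ℤ) : ℂ)]
  -- The first involution has the eigenvalues `s 0` and `-s 0` on the two summands of `w`, which are
  -- therefore linearly independent.
  have hw0 : w ≠ 0 := by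
    intro h0
    have hi : 0 < 2 * r := by omega
    have hA : gammaSq r V ⟨0, hi⟩ (chirL r V v) = -(s ⟨0, hi⟩ • chirL r V v) := by
      rw [← map_smul, ← h]
      exact LinearMap.congr_fun (gammaSq_mul_chirL r V ⟨0, hi⟩) v
    have h1 := congrArg (fun w => s ⟨0, hi⟩ • gammaSq r V ⟨0, hi⟩ w) h0
    simp only [hw, map_add, map_smul, h, hA, map_zero, smul_zero, smul_add, smul_neg] at h1
    rw [smul_comm (s _) ((ε : ℤ) : ℂ)] at h1
    simp only [smul_smul, hs1, one_smul] at h1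
    have h2 : (2 : ℂ) • v = (v + ((ε : ℤ) : ℂ) • chirL r V v) +
        (v + -(((ε : ℤ) : ℂ) • chirL r V v)) := by module
    rw [← hw, h0, h1, add_zero] at h2
    exact hv ((smul_eq_zero.1 h2).resolve_left two_ne_zero)
  have hJ : (∑ i, gammaSq r V i) ((∑ i, gammaSq r V i) w) = ((2 * j : ℂ) * (2 * j)) • w := by
    have hv1 := sum_gammaSq_apply r V h
    have hJL : ∀ u, (∑ i, gammaSq r V i) (chirL r V u) = -chirL r V ((∑ i, gammaSq r V i) u) :=
      fun u => LinearMap.congr_fun (sum_gammaSq_mul_chirL r V) u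
    rw [hsum] at hv1
    simp only [hw, map_add, map_smul, hJL, hv1, map_neg, smul_add, smul_smul]
    module
  refine Module.End.hasEigenvalue_of_hasEigenvector (x := ⟨w, hwmem⟩)
    ⟨Module.End.mem_eigenspace_iff.2 (Subtype.ext ?_), fun h0 => hw0 (congrArg Subtype.val h0)⟩
  rw [coe_casimirChiral V hr b, casimirRho_eq V hr b]
  simp only [LinearMap.smul_apply, LinearMap.sub_apply, Module.End.mul_apply, hJ,
    Module.End.one_apply, Submodule.coe_smul]
  module

end Chiral

/-! ### Characteristic identities -/

/-- An annihilating polynomial has every eigenvalue as a root; with as many known eigenvalues as its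
degree, these are all its roots, and they are simple. -/
theorem isCharacteristicIdentity_of_card {W : Type*} [AddCommGroup W] [Module ℂ W]
    {T : Module.End ℂ W} {p : Polynomial ℂ} (hp0 : p ≠ 0) (hp : Polynomial.aeval T p = 0)
    {S : Finset ℂ} (hS : ∀ μ ∈ S, T.HasEigenvalue μ) (hd : p.natDegree = S.card) :
    IsCharacteristicIdentity T p := by
  have hroot : ∀ q : Polynomial ℂ, Polynomial.aeval T q = 0 → ∀ μ, T.HasEigenvalue μ →
      q.IsRoot μ := by
    intro q hq μ hμ
    obtain ⟨v, hv⟩ := hμ.exists_hasEigenvector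
    have h := Module.End.aeval_apply_of_hasEigenvector (p := q) hv
    rw [hq, LinearMap.zero_apply] at h
    exact (smul_eq_zero.1 h.symm).resolve_right hv.2
  have hle : ∀ q : Polynomial ℂ, q ≠ 0 → Polynomial.aeval T q = 0 → S.val ≤ q.roots := by
    intro q hq0 hq
    rw [Multiset.le_iff_subset S.nodup]
    exact fun μ hμ => (Polynomial.mem_roots hq0).2 (hroot q hq μ (hS μ hμ))
  have hroots : S.val = p.roots :=
    Multiset.eq_of_le_of_card_le (hle p hp0 hp) ((Polynomial.card_roots' p).trans hd.le)
  refine ⟨⟨p.leadingCoeff, S, Polynomial.leadingCoeff_ne_zero.2 hp0, fun μ => ⟨hS μ, fun hμ => ?_⟩,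
    ?_⟩, hp, fun q hq0 hq => ?_⟩
  · rw [← Finset.mem_val, hroots, Polynomial.mem_roots hp0]
    exact hroot p hp μ hμ
  · conv_lhs => rw [← Polynomial.C_leadingCoeff_mul_prod_multiset_X_sub_C
      (p := p) (by rw [← hroots, hd]; rfl)]
    rw [← hroots]; rfl
  · rw [hd]
    exact (Multiset.card_le_card (hle q hq0 hq)).trans (Polynomial.card_roots' q)

section Chiral

variable {r : ℕ} (V : Type*) [AddCommGroup V] [Module ℂ V] [Module (Cl r) V]
  [IsScalarTower ℂ (Cl r) V]

/-- On a chiral subspace `∏ ρ(Γ_i) ⊗ ρ(Γ_i)` is a sign, so that `I_k` and `I_{2r-k}` are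
proportional. -/
theorem invariantI_apply_of_mem {ε ε' : ℤˣ} {k l : ℕ} (hkl : k + l = 2 * r) {w : V ⊗[ℂ] V}
    (hw : w ∈ ChiralSpace r V ε ε') :
    ((l.factorial : ℂ) * ((-1) ^ r * (((ε : ℤ) : ℂ) * ((ε' : ℤ) : ℂ)))) • invariantI r V k w =
      (k.factorial : ℂ) • invariantI r V l w := by
  obtain ⟨h1, h2⟩ := (mem_chiralSpace r V).1 hw
  have h := LinearMap.congr_fun
    (tupleSum_mul_prod (gammaSq_comm r V) (gammaSq_mul_self r V) hkl) w
  rw [prod_gammaSq, ← invariantI_eq, ← invariantI_eq] at h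
  simp only [Module.End.mul_apply, LinearMap.smul_apply, h1, h2, map_smul, smul_smul,
    Module.End.natCast_apply] at h
  simp only [← Nat.cast_smul_eq_nsmul ℂ, smul_smul] at h
  rw [← h]
  congr 1
  ring

theorem invariantI_sub_smul_apply {ε ε' : ℤˣ} {k l : ℕ} (hkl : k + l = 2 * r) {w : V ⊗[ℂ] V}
    (hw : w ∈ ChiralSpace r V ε ε') {c : ℂ} (hc : (k.factorial : ℂ) * c =
      (l.factorial : ℂ) * ((-1) ^ r * (((ε : ℤ) : ℂ) * ((ε' : ℤ) : ℂ)))) :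
    invariantI r V l w - c • invariantI r V k w = 0 := by
  have h := invariantI_apply_of_mem V hkl hw
  rw [← hc, mul_smul, ← sub_eq_zero, ← smul_sub] at h
  have h2 := (smul_eq_zero.1 h).resolve_left (Nat.cast_ne_zero.2 k.factorial_ne_zero)
  rw [← neg_sub, h2, neg_zero]

variable (hr : 2 ≤ r) {ι : Type*} [Fintype ι] [DecidableEq ι] (b : Module.Basis ι ℂ (so r))
include hr

/-- The `d` eigenvalues counted are those with `j = 2 t + δ`, `t < d`, in
`hasEigenvalue_casimirChiral`, where `δ` is `0` for equal and `1` for opposite chiralities. -/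
theorem isCharacteristicIdentity_casimirChiral [Nontrivial V] {ε ε' : ℤˣ} {d δ : ℕ}
    (hd : ∀ t < d, 2 * t + δ ≤ r) (hε : ((ε : ℤ) : ℂ) * ((ε' : ℤ) : ℂ) = (-1) ^ δ)
    {p : Polynomial ℂ} (hdeg : p.degree = d)
    (hp : ∀ w ∈ ChiralSpace r V ε ε', Polynomial.aeval (casimirRho r V b) p w = 0) :
    IsCharacteristicIdentity (casimirChiral r V b ε ε') p ∧ p.natDegree = d := by
  have hr1 : (r : ℂ) - 1 ≠ 0 := by
    rw [sub_ne_zero]; exact_mod_cast (show r ≠ 1 by omega)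
  have hnd := Polynomial.natDegree_eq_of_degree_eq_some hdeg
  have hp0 : p ≠ 0 := by rintro rfl; simp at hdeg
  set μ : ℕ → ℂ := fun j => (-32 * ((r : ℂ) - 1))⁻¹ * ((2 * j) * (2 * j) - 2 * r) with hμ
  have hinj : Function.Injective μ := by
    intro i j hij
    have h1 := mul_left_cancel₀ (inv_ne_zero (mul_ne_zero (by norm_num) hr1)) hij
    have h2 : ((i * i : ℕ) : ℂ) = ((j * j : ℕ) : ℂ) := by
      push_cast; linear_combination h1 / 4
    exact Nat.mul_self_inj.1 (Nat.cast_injective h2)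
  refine ⟨isCharacteristicIdentity_of_card hp0 ?_
    (S := (Finset.range d).image fun t => μ (2 * t + δ)) ?_ ?_, hnd⟩
  · ext w
    rw [coe_aeval_casimirChiral V hr b]
    exact hp w.1 w.2
  · intro ν hν
    obtain ⟨t, ht, rfl⟩ := Finset.mem_image.1 hν
    refine hasEigenvalue_casimirChiral V hr b ε ε' (hd t (Finset.mem_range.1 ht)) ?_
    rw [hε, pow_add, pow_mul]; simp
  · rw [Finset.card_image_of_injective _ fun s t h => by have := hinj h; omega, Finset.card_range,
      hnd]

theorem aeval_polyI_sub_apply (m m' : ℕ) (c : ℂ) (w : V ⊗[ℂ] V) :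
    Polynomial.aeval (casimirRho r V b) (polyI r m - Polynomial.C c * polyI r m') w =
      invariantI r V (2 * m) w - c • invariantI r V (2 * m') w := by
  rw [map_sub, map_mul, Polynomial.aeval_C, aeval_casimirRho r V hr, aeval_casimirRho r V hr]
  rfl

end Chiral

end SpinorCasimir

end

theorem mainTheorem3 (r : ℕ) (hr : 2 ≤ r)
    {V : Type*} [AddCommGroup V] [Module ℂ V] [Module (SpinorCasimir.Cl r) V]
    [IsScalarTower ℂ (SpinorCasimir.Cl r) V] [IsSimpleModule (SpinorCasimir.Cl r) V]
    {ι : Type*} [Fintype ι] [DecidableEq ι]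
    (b : Module.Basis ι ℂ (SpinorCasimir.so r)) :
    -- `polyI r k` expresses the invariant `I_{2k}` as a polynomial of degree `k` in `Ĉ_ρ`
    (∀ k : ℕ, (SpinorCasimir.polyI r k).natDegree = k ∧
      Polynomial.aeval (SpinorCasimir.casimirRho r V b) (SpinorCasimir.polyI r k) =
        SpinorCasimir.invariantI r V (2 * k)) ∧
    (Even r → ∀ ε : ℤˣ,
      (SpinorCasimir.IsCharacteristicIdentity (SpinorCasimir.casimirChiral r V b ε (-ε))
          (SpinorCasimir.polyI r (r / 2)) ∧
        (SpinorCasimir.polyI r (r / 2)).natDegree = r / 2) ∧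
      (SpinorCasimir.IsCharacteristicIdentity (SpinorCasimir.casimirChiral r V b ε ε)
          (SpinorCasimir.polyI r (r / 2 + 1) -
            Polynomial.C ((r : ℂ) * ((r : ℂ) ^ 2 - 1) * ((r : ℂ) + 2)) *
              SpinorCasimir.polyI r (r / 2 - 1)) ∧
        (SpinorCasimir.polyI r (r / 2 + 1) -
            Polynomial.C ((r : ℂ) * ((r : ℂ) ^ 2 - 1) * ((r : ℂ) + 2)) *
              SpinorCasimir.polyI r (r / 2 - 1)).natDegree = r / 2 + 1)) ∧
    (Odd r → ∀ ε : ℤˣ,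
      (SpinorCasimir.IsCharacteristicIdentity (SpinorCasimir.casimirChiral r V b ε (-ε))
          (SpinorCasimir.polyI r ((r + 1) / 2) -
            Polynomial.C ((r : ℂ) * ((r : ℂ) + 1)) * SpinorCasimir.polyI r ((r - 1) / 2)) ∧
        (SpinorCasimir.polyI r ((r + 1) / 2) -
            Polynomial.C ((r : ℂ) * ((r : ℂ) + 1)) *
              SpinorCasimir.polyI r ((r - 1) / 2)).natDegree = (r + 1) / 2) ∧
      (SpinorCasimir.IsCharacteristicIdentity (SpinorCasimir.casimirChiral r V b ε ε)
          (SpinorCasimir.polyI r ((r + 1) / 2) +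
            Polynomial.C ((r : ℂ) * ((r : ℂ) + 1)) * SpinorCasimir.polyI r ((r - 1) / 2)) ∧
        (SpinorCasimir.polyI r ((r + 1) / 2) +
            Polynomial.C ((r : ℂ) * ((r : ℂ) + 1)) *
              SpinorCasimir.polyI r ((r - 1) / 2)).natDegree = (r + 1) / 2)) := by
  have : Nontrivial V := IsSimpleModule.nontrivial (SpinorCasimir.Cl r) V
  refine ⟨fun k => ⟨Polynomial.natDegree_eq_of_degree_eq_some (SpinorCasimir.degree_polyI r hr k),
    SpinorCasimir.aeval_casimirRho r V hr b k⟩, ?_, ?_⟩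
  · rintro ⟨q, rfl⟩ ε
    have hsign : ((-1 : ℂ)) ^ (q + q) = 1 := Even.neg_one_pow ⟨q, rfl⟩
    have hq1 : (q + q) / 2 = q := by omega
    have hε := SpinorCasimir.unit_mul_self_complex ε
    have hε' : ((ε : ℤ) : ℂ) * (((-ε : ℤˣ) : ℤ) : ℂ) = -1 := by
      push_cast; linear_combination -hε
    rw [hq1]
    constructor
    · refine SpinorCasimir.isCharacteristicIdentity_casimirChiral V hr b (δ := 1)
        (fun t ht => by omega) (by rw [hε', pow_one]) (SpinorCasimir.degree_polyI _ hr q)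
        fun w hw => ?_
      -- In the middle degree `k = r` the proportionality reads `I_r = -I_r`.
      have h := SpinorCasimir.invariantI_sub_smul_apply V (k := 2 * q) (l := 2 * q) (by ring) hw
        (c := -1) (by rw [hε', hsign, one_mul])
      rw [neg_one_smul, sub_neg_eq_add, ← two_smul ℂ] at h
      rw [SpinorCasimir.aeval_casimirRho _ V hr]
      exact (smul_eq_zero.1 h).resolve_left two_ne_zero
    · refine SpinorCasimir.isCharacteristicIdentity_casimirChiral V hr b (δ := 0)
        (fun t ht => by omega) (by rw [hε, pow_zero])
        (SpinorCasimir.degree_polyI_sub _ hr (by omega) _) fun w hw => ?_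
      obtain ⟨q, rfl⟩ : ∃ m, q = m + 1 := ⟨q - 1, by omega⟩
      rw [SpinorCasimir.aeval_polyI_sub_apply V hr, Nat.add_sub_cancel]
      refine SpinorCasimir.invariantI_sub_smul_apply V (by ring) hw ?_
      rw [hε, hsign, show 2 * (q + 2) = 2 * q + 1 + 1 + 1 + 1 by ring]
      simp only [Nat.factorial_succ]
      push_cast
      ring
  · rintro ⟨q, rfl⟩ ε
    have hsign : ((-1 : ℂ)) ^ (2 * q + 1) = -1 := Odd.neg_one_pow ⟨q, rfl⟩
    have hq1 : (2 * q + 1 + 1) / 2 = q + 1 := by omega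
    have hq2 : (2 * q + 1 - 1) / 2 = q := by omega
    have hε := SpinorCasimir.unit_mul_self_complex ε
    have hε' : ((ε : ℤ) : ℂ) * (((-ε : ℤˣ) : ℤ) : ℂ) = -1 := by
      push_cast; linear_combination -hε
    rw [hq1, hq2]
    constructor
    · refine SpinorCasimir.isCharacteristicIdentity_casimirChiral V hr b (δ := 1)
        (fun t ht => by omega) (by rw [hε', pow_one])
        (SpinorCasimir.degree_polyI_sub _ hr (by omega) _) fun w hw => ?_
      rw [SpinorCasimir.aeval_polyI_sub_apply V hr]
      refine SpinorCasimir.invariantI_sub_smul_apply V (by ring) hw ?_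
      rw [hε', hsign, show 2 * (q + 1) = 2 * q + 1 + 1 by ring]
      simp only [Nat.factorial_succ]
      push_cast
      ring
    · rw [← sub_neg_eq_add, ← neg_mul, ← Polynomial.C_neg]
      refine SpinorCasimir.isCharacteristicIdentity_casimirChiral V hr b (δ := 0)
        (fun t ht => by omega) (by rw [hε, pow_zero])
        (SpinorCasimir.degree_polyI_sub _ hr (by omega) _) fun w hw => ?_
      rw [SpinorCasimir.aeval_polyI_sub_apply V hr]
      refine SpinorCasimir.invariantI_sub_smul_apply V (by ring) hw ?_
      rw [hε, hsign, show 2 * (q + 1) = 2 * q + 1 + 1 by ring]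
      simp only [Nat.factorial_succ]
      push_cast
      ring
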